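/- Let $n\ge 0$ and let $\lambda$ be a partition of $2n$. The type-$B$ $0$-Hecke algebra $H_n^B(0)$ is the unital $\mathbb C$-algebra generated by $\pi_0,\dots,\pi_{n-1}$ subject to $\pi_i^2=-\pi_i$ for all $i$; $\pi_i\pi_j=\pi_j\pi_i$ if $|i-j|\ge 2$; $\pi_i\pi_{i+1}\pi_i=\pi_{i+1}\pi_i\pi_{i+1}$ for $1\le i\le n-2$; and $\pi_0\pi_1\pi_0\pi_1=\pi_1\pi_0\pi_1\pi_0$ (if $n\ge 2$). For $I\subseteq\{0,\dots,n-1\}$, let $\mathcal S_I^B$ be the one-dimensional $H_n^B(0)$-module on which $\pi_j$ acts as $-1$ if $j\in I$ and as $0$ if $j\notin I$. Let $\mathcal G_0(H_n^B(0))$ be the Grothendieck group of finitely generated $H_n^B(0)$-modules (generated by the classes $[M]$, with $[A]-[B]+[C]=0$ for every short exact sequence $0\to A\to B\to C\to 0$). Let $\mathrm{QSym}^B$ be the space of type-$B$ quasisymmetric functions: the power series over $\mathbb C$ in $x_0,x_1,x_2,\dots$ of bounded degree in which, for all $k\ge0$, $a_0\ge 0$ and $a_1,\dots,a_k\ge 1$,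 the coefficients of $x_0^{a_0}x_{i_1}^{a_1}\cdots x_{i_k}^{a_k}$ and $x_0^{a_0}x_{j_1}^{a_1}\cdots x_{j_k}^{a_k}$ agree whenever $0<i_1<\dots<i_k$ and $0<j_1<\dots<j_k$. For $I\subseteq\{0,\dots,n-1\}$ put \[F_I^B=\sum_{\substack{0=i_0\le i_1\le\cdots\le i_n\\ j\in I\Rightarrow i_j<i_{j+1}}}x_{i_1}x_{i_2}\cdots x_{i_n}\in\mathrm{QSym}^B .\] A type-$B$ quasisymmetric characteristic is a group homomorphism $\mathrm{ch}^B:\mathcal G_0(H_n^B(0))\to\mathrm{QSym}^B$ with $\mathrm{ch}^B([\mathcal S_I^B])=F_I^B$ for all $I\subseteq\{0,\dots,n-1\}$. A standard domino tableau of shape $\lambda$ is a tiling of the Young diagram of $\lambda$ (English notation) by $1\times2$ and $2\times1$ dominoes together with a bijective filling of the dominoes with $1,\dots,n$ whose entries increase from left to right along rows and from top to bottom along columns; $\mathsf{SDT}(\lambda)$ is the set of these, and $\mathrm{dom}_i(T)$ is the domino of $T$ with entry $i$. The descent set $\mathrm{Des}(T)\subseteq\{0,\dots,n-1\}$ contains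 $0$ iff $n\ge1$ and $\mathrm{dom}_1(T)$ is vertical, and contains $i$ with $1\le i\le n-1$ iff $\mathrm{dom}_{i+1}(T)$ is strictly lower than $\mathrm{dom}_i(T)$ (every cell of the former is in a strictly lower row than every cell of the latter). For $1\le i\le n-1$, $s_i(T)$ is the filling obtained by exchanging the entries $i$ and $i+1$. If $\mathrm{dom}_1(T)$ and $\mathrm{dom}_2(T)$ tile the northwest-most $2\times2$ square, $s_0(T)$ is obtained by switching the orientation of both, with $1$ placed left of $2$ if $1$ was above $2$ in $T$, and $1$ placed above $2$ if $1$ was left of $2$; otherwise $s_0(T)$ is undefined and is regarded as not belonging to $\mathsf{SDT}(\lambda)$. On the complex vector space $\mathbb C\,\mathsf{SDT}(\lambda)$ with basis $\mathsf{SDT}(\lambda)$ define linear operators, for $0\le i\le n-1$, \[\pi_i(T)=\begin{cases}-T & i\in\mathrm{Des}(T),\\ 0 & i\notin\mathrm{Des}(T),\ s_i(T)\notin\mathsf{SDT}(\lambda),\\ s_i(T) & i\notin\mathrm{Des}(T),\ s_i(T)\in\mathsf{SDT}(\lambda).\end{cases}\] The Mayorova--Vassilieva domino function is $G_\lambda=\sum_{T\in\mathsf{SDT}(\lambda)}F^B_{\mathrm{Des}(T)}$.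 Theorem. A type-$B$ quasisymmetric characteristic $\mathrm{ch}^B$ exists; the operators $\pi_0,\dots,\pi_{n-1}$ define an action of $H_n^B(0)$ on $\mathbb C\,\mathsf{SDT}(\lambda)$; and, for this module and every type-$B$ quasisymmetric characteristic $\mathrm{ch}^B$, \[\mathrm{ch}^B\bigl([\mathbb C\,\mathsf{SDT}(\lambda)]\bigr)=G_\lambda .\] -/

import Mathlib

namespace DominoHecke

/-! ### The type-`B` 0-Hecke algebra -/

/-- Defining relations of the type-`B` 0-Hecke algebra on generators `π₀, …, π_{n-1}`. -/
inductive HeckeRel (n : ℕ) : FreeAlgebra ℂ (Fin n) → FreeAlgebra ℂ (Fin n) → Prop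
  | sq (i : Fin n) :
      HeckeRel n (FreeAlgebra.ι ℂ i * FreeAlgebra.ι ℂ i) (-FreeAlgebra.ι ℂ i)
  | comm (i j : Fin n) (h : i.val + 2 ≤ j.val) :
      HeckeRel n (FreeAlgebra.ι ℂ i * FreeAlgebra.ι ℂ j)
        (FreeAlgebra.ι ℂ j * FreeAlgebra.ι ℂ i)
  | braid (i j : Fin n) (hi : 1 ≤ i.val) (hj : j.val = i.val + 1) :
      HeckeRel n (FreeAlgebra.ι ℂ i * FreeAlgebra.ι ℂ j * FreeAlgebra.ι ℂ i)
        (FreeAlgebra.ι ℂ j * FreeAlgebra.ι ℂ i * FreeAlgebra.ι ℂ j)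
  | braidFour (i j : Fin n) (hi : i.val = 0) (hj : j.val = 1) :
      HeckeRel n
        (FreeAlgebra.ι ℂ i * FreeAlgebra.ι ℂ j * FreeAlgebra.ι ℂ i * FreeAlgebra.ι ℂ j)
        (FreeAlgebra.ι ℂ j * FreeAlgebra.ι ℂ i * FreeAlgebra.ι ℂ j * FreeAlgebra.ι ℂ i)

/-- The type-`B` 0-Hecke algebra `H_n^B(0)` over `ℂ`. -/
abbrev HeckeB (n : ℕ) : Type := RingQuot (HeckeRel n)

/-- The generator `π_i`, for `0 ≤ i ≤ n - 1`. -/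
noncomputable def gen {n : ℕ} (i : Fin n) : HeckeB n :=
  RingQuot.mkAlgHom ℂ (HeckeRel n) (FreeAlgebra.ι ℂ i)

/-- The underlying space of an algebra homomorphism `ρ : H_n^B(0) → End_ℂ(V)`,
regarded as an `H_n^B(0)`-module with `a • v = ρ a v`. -/
def RepModule {n : ℕ} {V : Type} [AddCommGroup V] [Module ℂ V]
    (_ρ : HeckeB n →ₐ[ℂ] Module.End ℂ V) : Type := V

section RepModule

variable {n : ℕ} {V : Type} [AddCommGroup V] [Module ℂ V]
  (ρ : HeckeB n →ₐ[ℂ] Module.End ℂ V)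

instance : AddCommGroup (RepModule ρ) := inferInstanceAs (AddCommGroup V)

instance : Module ℂ (RepModule ρ) := inferInstanceAs (Module ℂ V)

noncomputable instance : Module (HeckeB n) (RepModule ρ) :=
  Module.compHom V ρ.toRingHom

instance : IsScalarTower ℂ (HeckeB n) (RepModule ρ) where
  smul_assoc c a v := by
    change ρ (c • a) v = c • (ρ a v)
    rw [map_smul]
    rfl

instance [Module.Finite ℂ V] : Module.Finite (HeckeB n) (RepModule ρ) :=
  haveI : Module.Finite ℂ (RepModule ρ) := inferInstanceAs (Module.Finite ℂ V)
  Module.Finite.of_restrictScalars_finite ℂ (HeckeB n) (RepModule ρ)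

end RepModule

/-- The character of `H_n^B(0)` sending `π_j` to `-1` if `j ∈ I` and to `0` otherwise. -/
noncomputable def simpleChar {n : ℕ} (I : Finset (Fin n)) : HeckeB n →ₐ[ℂ] ℂ :=
  RingQuot.liftAlgHom ℂ
    ⟨FreeAlgebra.lift ℂ (fun j : Fin n => if j ∈ I then (-1 : ℂ) else 0), by
      intro x y h
      cases h <;> simp only [map_mul, map_neg, FreeAlgebra.lift_ι_apply] <;>
        split_ifs <;> norm_num⟩

/-- The one-dimensional simple module `S_I^B`, with underlying space `ℂ`. -/
abbrev SimpleB {n : ℕ} (I : Finset (Fin n)) : Type :=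
  RepModule ((Algebra.ofId ℂ (Module.End ℂ ℂ)).comp (simpleChar I))

/-! ### The Grothendieck group of finitely generated modules -/

/-- A finitely generated `H_n^B(0)`-module. -/
structure FGMod (n : ℕ) : Type 1 where
  carrier : Type
  [addCommGroup : AddCommGroup carrier]
  [module : Module (HeckeB n) carrier]
  [finite : Module.Finite (HeckeB n) carrier]

attribute [instance] FGMod.addCommGroup FGMod.module FGMod.finite

/-- The elements `[A] - [B] + [C]` for short exact sequences `0 → A → B → C → 0`.
(The sequences with `A = B = C = 0` and with `C = 0` identify isomorphic modules.) -/
def exactRelations (n : ℕ) : Set (FreeAbelianGroup (FGMod n)) :=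
  {x | ∃ (A B C : FGMod n)
      (f : A.carrier →ₗ[HeckeB n] B.carrier) (g : B.carrier →ₗ[HeckeB n] C.carrier),
      Function.Injective f ∧ Function.Exact f g ∧ Function.Surjective g ∧
      x = FreeAbelianGroup.of A - FreeAbelianGroup.of B + FreeAbelianGroup.of C}

/-- The Grothendieck group `𝒢₀(H_n^B(0))`. -/
abbrev G0 (n : ℕ) : Type 1 :=
  FreeAbelianGroup (FGMod n) ⧸ AddSubgroup.closure (exactRelations n)

/-- The class `[M]` of a finitely generated module in the Grothendieck group. -/
def G0.cls (n : ℕ) (M : Type) [AddCommGroup M] [Module (HeckeB n) M]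
    [Module.Finite (HeckeB n) M] : G0 n :=
  QuotientAddGroup.mk (FreeAbelianGroup.of (FGMod.mk M))

/-! ### Type-`B` quasisymmetric functions -/

/-- The space `QSym^B` of type-`B` quasisymmetric functions in `x₀, x₁, x₂, …`: power series
of bounded degree in which two monomials have equal coefficients whenever one arises from the
other by a strictly increasing relabelling of the variables that fixes `x₀`. -/
def QSymB : Submodule ℂ (MvPowerSeries ℕ ℂ) where
  carrier := {f | (∃ d : ℕ, ∀ m : ℕ →₀ ℕ, MvPowerSeries.coeff m f ≠ 0 → m.degree ≤ d) ∧
    ∀ φ : ℕ → ℕ, StrictMono φ → φ 0 = 0 → ∀ m : ℕ →₀ ℕ,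
      MvPowerSeries.coeff (m.mapDomain φ) f = MvPowerSeries.coeff m f}
  zero_mem' := by simp
  add_mem' := by
    rintro f g ⟨⟨d, hd⟩, hf⟩ ⟨⟨e, he⟩, hg⟩
    refine ⟨⟨max d e, fun m hm => ?_⟩, fun φ h1 h2 m => ?_⟩
    · by_cases h : MvPowerSeries.coeff m f = 0
      · refine le_max_of_le_right (he m fun h' => hm ?_)
        rw [map_add, h, h', add_zero]
      · exact le_max_of_le_left (hd m h)
    · rw [map_add, map_add, hf φ h1 h2 m, hg φ h1 h2 m]
  smul_mem' := by
    rintro c f ⟨⟨d, hd⟩, hf⟩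
    refine ⟨⟨d, fun m hm => hd m fun h => hm ?_⟩, fun φ h1 h2 m => ?_⟩
    · rw [map_smul, h, smul_zero]
    · rw [map_smul, map_smul, hf φ h1 h2 m]

/-- The type-`B` fundamental quasisymmetric function
`F_I^B = ∑ x_{i₁} ⋯ x_{i_n}` over `0 = i₀ ≤ i₁ ≤ ⋯ ≤ i_n` with `i_j < i_{j+1}` for `j ∈ I`.
The coefficient of a monomial counts the sequences that produce it. -/
noncomputable def FB {n : ℕ} (I : Finset (Fin n)) : MvPowerSeries ℕ ℂ :=
  fun m => (Nat.card {i : Fin (n + 1) → ℕ // i 0 = 0 ∧ Monotone i ∧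
    (∀ j ∈ I, i j.castSucc < i j.succ) ∧
    ∑ k : Fin n, Finsupp.single (i k.succ) 1 = m} : ℂ)

/-- `ch` has the defining property of the type-`B` quasisymmetric characteristic: it is a
homomorphism on the Grothendieck group with `ch [S_I^B] = F_I^B` for all
`I ⊆ {0, …, n - 1}`. -/
def IsCharB {n : ℕ} (ch : G0 n →+ QSymB) : Prop :=
  ∀ I : Finset (Fin n), (ch (G0.cls n (SimpleB I)) : MvPowerSeries ℕ ℂ) = FB I

/-! ### Standard domino tableaux

Cells are pairs (row, column) of natural numbers; rows are numbered from the top and columns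
from the left, as in `YoungDiagram`. -/

/-- A `1 × 2` rectangle. -/
def IsHorizontal (d : Finset (ℕ × ℕ)) : Prop := ∃ r c : ℕ, d = {(r, c), (r, c + 1)}

/-- A `2 × 1` rectangle. -/
def IsVertical (d : Finset (ℕ × ℕ)) : Prop := ∃ r c : ℕ, d = {(r, c), (r + 1, c)}

/-- A standard domino tableau of shape `μ` with `n` dominoes: `dom k` is the domino with entry
`k + 1`. The dominoes tile `μ`, and entries increase along rows and down columns (weakly as one
passes from cell to cell, hence strictly from domino to domino). -/
@[ext]
structure SDT (μ : YoungDiagram) (n : ℕ) where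
  dom : Fin n → Finset (ℕ × ℕ)
  isDomino : ∀ k, IsHorizontal (dom k) ∨ IsVertical (dom k)
  disjoint : ∀ k l, k ≠ l → Disjoint (dom k) (dom l)
  cover : Finset.univ.biUnion dom = μ.cells
  row_le : ∀ k l, ∀ a ∈ dom k, ∀ b ∈ dom l, a.1 = b.1 → a.2 < b.2 → k ≤ l
  col_le : ∀ k l, ∀ a ∈ dom k, ∀ b ∈ dom l, a.2 = b.2 → a.1 < b.1 → k ≤ l

instance (μ : YoungDiagram) (n : ℕ) : Finite (SDT μ n) := by
  refine Finite.of_injective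
    (fun T : SDT μ n => fun k : Fin n => (⟨T.dom k, ?_⟩ : {d // d ∈ μ.cells.powerset})) ?_
  · rw [Finset.mem_powerset, ← T.cover]
    exact Finset.subset_biUnion_of_mem T.dom (Finset.mem_univ k)
  · intro T T' h
    ext1
    funext k
    exact congrArg Subtype.val (congrFun h k)

noncomputable instance (μ : YoungDiagram) (n : ℕ) : Fintype (SDT μ n) := Fintype.ofFinite _

variable {μ : YoungDiagram} {n : ℕ}

/-- The index below `i`; used only for `i ≠ 0`. -/
def pred (i : Fin n) : Fin n := ⟨i.val - 1, lt_of_le_of_lt (Nat.sub_le _ _) i.isLt⟩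

/-- `i` is a descent of `T` if `i = 0` and the domino with entry `1` is vertical, or `i > 0` and
the domino with entry `i + 1` lies strictly lower than the domino with entry `i`. -/
def IsDescent (T : SDT μ n) (i : Fin n) : Prop :=
  (i.val = 0 ∧ IsVertical (T.dom i)) ∨
  (0 < i.val ∧ ∀ a ∈ T.dom (pred i), ∀ b ∈ T.dom i, a.1 < b.1)

open Classical in
/-- The descent set of `T`. -/
noncomputable def Des (T : SDT μ n) : Finset (Fin n) :=
  Finset.univ.filter fun i => IsDescent T i

/-- The domino `d` reflected in the main diagonal. -/
def reflect (d : Finset (ℕ × ℕ)) : Finset (ℕ × ℕ) := d.image Prod.swap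

/-- The filling `s_i(T)` when it is defined. For `i > 0` the entries `i` and `i + 1` are
exchanged; the result need not be a standard domino tableau. For `i = 0` it is defined when the
dominoes with entries `1` and `2` tile the northwest `2 × 2` square; these two dominoes are then
reflected in the main diagonal, so that both change orientation, and `1` above `2` becomes `1`
left of `2` and vice versa. -/
def sFilling (T : SDT μ n) (i : Fin n) : Option (Fin n → Finset (ℕ × ℕ)) :=
  if i.val = 0 then
    if h : 1 < n then
      if T.dom i ∪ T.dom ⟨1, h⟩ = {(0, 0), (0, 1), (1, 0), (1, 1)} then
        some fun k => if k.val ≤ 1 then reflect (T.dom k) else T.dom k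
      else none
    else none
  else some (T.dom ∘ Equiv.swap (pred i) i)

open Classical in
/-- The value of the operator `π_i` on the basis element `T` of `ℂ SDT(μ)`. -/
noncomputable def opBasis (i : Fin n) (T : SDT μ n) : SDT μ n →₀ ℂ :=
  if i ∈ Des T then -Finsupp.single T 1
  else if h : ∃ T' : SDT μ n, sFilling T i = some T'.dom then Finsupp.single h.choose 1
  else 0

/-- The linear operator `π_i` on `ℂ SDT(μ)`. -/
noncomputable def op (μ : YoungDiagram) {n : ℕ} (i : Fin n) : Module.End ℂ (SDT μ n →₀ ℂ) :=
  Finsupp.linearCombination ℂ (opBasis i)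

/-- The domino function `G_μ`. -/
noncomputable def dominoFunction (μ : YoungDiagram) (n : ℕ) : MvPowerSeries ℕ ℂ :=
  ∑ T : SDT μ n, FB (Des T)

end DominoHecke

/-!
Let `A_m` be the subalgebra of `H_n^B(0)` generated by `π₀, …, π_{m-1}`. The palindrome
`q_m = π_m ⋯ π₀ ⋯ π_m` commutes with `A_m`, and `A_{m+1} = A_m + A_m π_m A_m + A_m q_m`; by
induction `H_n^B(0)` is finite-dimensional, so its elements have traces on finitely generated
modules. The product over `j` of the factors `-π_j` (`j ∈ J`) and `1 + π_j` (`j ∉ J`) acts on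
`S_I^B` by `1` if `I = J` and by `0` otherwise. Its trace is additive on short exact sequences, so
the combination of these traces with the coefficients `F_J^B` is a characteristic.

For `i ≥ 1` the operator `π_i` is the restriction to tableaux of the operator sorting two adjacent
letters of a word of dominoes for the strict order of lying strictly above, and sorting operators
satisfy the relations for every strict order. The operator `π₀` only involves the
dominoes with entries `1` and `2`: it reflects a northwest square tiled by horizontal dominoes.

Outside descents each `π_i` either kills a tableau or moves it to one of larger height, so
filtering by height makes `ℂ SDT(μ)` an iterated extension of the simple modules `S_{Des T}^B`.
-/

namespace DominoHecke

/-! ### Finite generation of the type-`B` 0-Hecke algebra -/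

theorem adjoin_le_of_mul_mem {K R : Type*} [CommSemiring K] [Semiring R] [Algebra K R] {S : Set R}
    {X : Submodule K R} (one_mem : 1 ∈ X) (mul_mem : ∀ s ∈ S, ∀ x ∈ X, s * x ∈ X) :
    Subalgebra.toSubmodule (Algebra.adjoin K S) ≤ X := by
  rw [Algebra.adjoin_eq_span, Submodule.span_le]
  intro a ha
  induction ha using Submonoid.closure_induction_left with
  | one => exact one_mem
  | mul_left s hs a _ ih => exact mul_mem s hs a ih

/-- A sequence in a ring satisfying the relations of the type-`B` 0-Hecke generators. The
sequence is infinite, so that induction on the rank stays inside one ring; finitely many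
generators are extended by zero. -/
structure IsHeckeSequence {R : Type*} [Ring R] (p : ℕ → R) : Prop where
  sq : ∀ i, p i * p i = -p i
  comm : ∀ i j, i + 2 ≤ j → Commute (p i) (p j)
  braid : ∀ i, 1 ≤ i → p i * p (i + 1) * p i = p (i + 1) * p i * p (i + 1)
  braidFour : p 0 * p 1 * p 0 * p 1 = p 1 * p 0 * p 1 * p 0

/-- The palindrome `p_m ⋯ p₁ p₀ p₁ ⋯ p_m`. -/
def palindrome {R : Type*} [Mul R] (p : ℕ → R) : ℕ → R
  | 0 => p 0
  | m + 1 => p (m + 1) * palindrome p m * p (m + 1)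

namespace IsHeckeSequence

variable {R : Type*} [Ring R] {p : ℕ → R}

theorem commute_palindrome_of_le (hp : IsHeckeSequence p) {m j : ℕ} (h : m + 2 ≤ j) :
    Commute (palindrome p m) (p j) := by
  induction m with
  | zero => exact hp.comm 0 j h
  | succ m ih =>
    exact ((hp.comm _ _ h).mul_left (ih (by omega))).mul_left (hp.comm _ _ h)

theorem commute_palindrome_succ (hp : IsHeckeSequence p) (m : ℕ) :
    Commute (palindrome p (m + 1)) (p m) := by
  cases m with
  | zero => simpa only [palindrome, Commute, SemiconjBy, zero_add, mul_assoc] using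
      hp.braidFour.symm
  | succ k =>
    have hb := hp.braid (k + 1) (by omega)
    have hc : palindrome p k * p (k + 2) = p (k + 2) * palindrome p k :=
      hp.commute_palindrome_of_le le_rfl
    calc p (k + 2) * (p (k + 1) * palindrome p k * p (k + 1)) * p (k + 2) * p (k + 1)
      _ = p (k + 2) * p (k + 1) * palindrome p k * (p (k + 1) * p (k + 2) * p (k + 1)) := by
          simp only [mul_assoc]
      _ = p (k + 2) * p (k + 1) * (palindrome p k * p (k + 2)) * p (k + 1) * p (k + 2) := by
          rw [hb]; simp only [mul_assoc]
      _ = p (k + 2) * p (k + 1) * p (k + 2) * palindrome p k * p (k + 1) * p (k + 2) := by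
          rw [hc]; simp only [mul_assoc]
      _ = p (k + 1) * (p (k + 2) * (p (k + 1) * palindrome p k * p (k + 1)) * p (k + 2)) := by
          rw [← hb]; simp only [mul_assoc]

theorem commute_palindrome_of_lt (hp : IsHeckeSequence p) {m j : ℕ} (h : j < m) :
    Commute (palindrome p m) (p j) := by
  induction m with
  | zero => omega
  | succ m ih =>
    rcases Nat.lt_succ_iff_lt_or_eq.1 h with hj | rfl
    · have hcomm := (hp.comm j (m + 1) (by omega)).symm
      exact (hcomm.mul_left (ih hj)).mul_left hcomm
    · exact hp.commute_palindrome_succ j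

theorem mul_palindrome (hp : IsHeckeSequence p) (m : ℕ) :
    p m * palindrome p m = -palindrome p m := by
  cases m with
  | zero => exact hp.sq 0
  | succ m => simp only [palindrome, ← mul_assoc, hp.sq, neg_mul]

end IsHeckeSequence

section DoubleCosets

open Submodule

variable (K : Type*) {R : Type*} [CommRing K] [Ring R] [Algebra K R] {p : ℕ → R}

/-- The subalgebra generated by `p₀, …, p_{m-1}`, viewed as a submodule so that it can be
multiplied by other submodules. -/
def initialSpan (p : ℕ → R) (m : ℕ) : Submodule K R :=
  Subalgebra.toSubmodule (Algebra.adjoin K (p '' Set.Iio m))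

/-- The sum of the double cosets of `1`, `p_m` and `p_m ⋯ p₀ ⋯ p_m` with respect to the subalgebra
generated by `p₀, …, p_{m-1}`. The palindrome commutes with that subalgebra, so its double coset
is one-sided. -/
def doubleCosets (p : ℕ → R) (m : ℕ) : Submodule K R :=
  initialSpan K p m + initialSpan K p m * (K ∙ p m) * initialSpan K p m +
    initialSpan K p m * (K ∙ palindrome p m)

variable {K} {m : ℕ}

theorem initialSpan_mul_self : initialSpan K p m * initialSpan K p m = initialSpan K p m :=
  (Subalgebra.isIdempotentElem_toSubmodule _).eq

theorem one_le_initialSpan : 1 ≤ initialSpan K p m :=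
  one_le.2 (one_mem (Algebra.adjoin K _))

theorem initialSpan_mono {k : ℕ} (h : k ≤ m) : initialSpan K p k ≤ initialSpan K p m :=
  Algebra.adjoin_mono (Set.image_mono (Set.Iio_subset_Iio h))

theorem mem_initialSpan {j : ℕ} (h : j < m) : p j ∈ initialSpan K p m :=
  Algebra.subset_adjoin ⟨j, h, rfl⟩

theorem palindrome_mem_initialSpan {j : ℕ} (h : j < m) : palindrome p j ∈ initialSpan K p m := by
  induction j with
  | zero => exact mem_initialSpan h
  | succ j ih =>
    have hj := mem_initialSpan (K := K) (p := p) h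
    exact initialSpan_mul_self.le (mul_mem_mul
      (initialSpan_mul_self.le (mul_mem_mul hj (ih (by omega)))) hj)

theorem commute_span_initialSpan {z : R} (hz : ∀ j < m, Commute z (p j)) :
    Commute (K ∙ z) (initialSpan K p m) := by
  have comm_mem : ∀ a ∈ initialSpan K p m, Commute z a := fun a ha =>
    Algebra.commute_of_mem_adjoin_of_forall_mem_commute ha
      (Set.forall_mem_image.2 fun j hj => hz j hj)
  ext x
  rw [mem_span_singleton_mul, mem_mul_span_singleton]
  exact exists_congr fun a => and_congr_right fun ha => by rw [(comm_mem a ha).eq]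

theorem initialSpan_le_doubleCosets : initialSpan K p m ≤ doubleCosets K p m :=
  le_sup_of_le_left le_sup_left

theorem mul_span_mul_le_doubleCosets :
    initialSpan K p m * (K ∙ p m) * initialSpan K p m ≤ doubleCosets K p m :=
  le_sup_of_le_left le_sup_right

theorem mul_span_palindrome_le_doubleCosets :
    initialSpan K p m * (K ∙ palindrome p m) ≤ doubleCosets K p m :=
  le_sup_right

theorem initialSpan_mul_doubleCosets :
    initialSpan K p m * doubleCosets K p m = doubleCosets K p m := by
  simp only [doubleCosets, mul_add, ← mul_assoc, initialSpan_mul_self]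

theorem doubleCosets_le_initialSpan_succ : doubleCosets K p m ≤ initialSpan K p (m + 1) := by
  have hA : initialSpan K p m ≤ initialSpan K p (m + 1) := initialSpan_mono m.le_succ
  have hP : K ∙ p m ≤ initialSpan K p (m + 1) :=
    (span_singleton_le_iff_mem _ _).2 (mem_initialSpan m.lt_succ_self)
  have hQ : K ∙ palindrome p m ≤ initialSpan K p (m + 1) :=
    (span_singleton_le_iff_mem _ _).2 (palindrome_mem_initialSpan m.lt_succ_self)
  refine sup_le (sup_le hA ?_) ?_
  · refine (mul_le_mul' (mul_le_mul' hA hP) hA).trans ?_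
    rw [initialSpan_mul_self, initialSpan_mul_self]
  · exact (mul_le_mul' hA hQ).trans initialSpan_mul_self.le

namespace IsHeckeSequence

theorem commute_span_palindrome_initialSpan (hp : IsHeckeSequence p) (m : ℕ) :
    Commute (K ∙ palindrome p m) (initialSpan K p m) :=
  commute_span_initialSpan fun _ => hp.commute_palindrome_of_lt

theorem span_mul_self (hp : IsHeckeSequence p) (m : ℕ) : (K ∙ p m) * (K ∙ p m) = K ∙ p m := by
  rw [span_mul_span, Set.singleton_mul_singleton, hp.sq, ← Set.neg_singleton, span_neg]

theorem doubleCosets_mul_initialSpan (hp : IsHeckeSequence p) :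
    doubleCosets K p m * initialSpan K p m = doubleCosets K p m := by
  have hQ := (hp.commute_span_palindrome_initialSpan (K := K) m).eq
  simp only [doubleCosets, add_mul, mul_assoc, initialSpan_mul_self, hQ]
  simp only [← mul_assoc, initialSpan_mul_self]

theorem span_mul_doubleCosets_le (hp : IsHeckeSequence p)
    (h : (K ∙ p m) * initialSpan K p m * (K ∙ p m) ≤ doubleCosets K p m) :
    (K ∙ p m) * doubleCosets K p m ≤ doubleCosets K p m := by
  have hQ := (hp.commute_span_palindrome_initialSpan (K := K) m).eq
  have hPQ : (K ∙ p m) * (K ∙ palindrome p m) = K ∙ palindrome p m := by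
    rw [span_mul_span, Set.singleton_mul_singleton, hp.mul_palindrome, ← Set.neg_singleton,
      span_neg]
  nth_rw 1 [doubleCosets]
  simp only [mul_add, ← mul_assoc]
  refine sup_le (sup_le ?_ ?_) ?_
  · refine le_trans ?_ mul_span_mul_le_doubleCosets
    simpa only [one_mul] using
      mul_le_mul_left (mul_le_mul_left (one_le_initialSpan (K := K) (p := p) (m := m)) _) _
  · exact (mul_le_mul_left h _).trans hp.doubleCosets_mul_initialSpan.le
  · rw [mul_assoc, ← hQ, ← mul_assoc, hPQ, hQ]
    exact mul_span_palindrome_le_doubleCosets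

theorem initialSpan_succ_of_span_mul_le (hp : IsHeckeSequence p)
    (h : (K ∙ p m) * initialSpan K p m * (K ∙ p m) ≤ doubleCosets K p m) :
    initialSpan K p (m + 1) = doubleCosets K p m := by
  refine le_antisymm (adjoin_le_of_mul_mem ?_ ?_) doubleCosets_le_initialSpan_succ
  · exact initialSpan_le_doubleCosets (one_le.1 one_le_initialSpan)
  · rintro _ ⟨j, hj, rfl⟩ x hx
    rcases Nat.lt_succ_iff_lt_or_eq.1 hj with hj | rfl
    · exact initialSpan_mul_doubleCosets.le (mul_mem_mul (mem_initialSpan hj) hx)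
    · exact hp.span_mul_doubleCosets_le h (mul_mem_mul (mem_span_singleton_self _) hx)

theorem span_mul_initialSpan_mul_span_le (hp : IsHeckeSequence p) {k : ℕ} (hkm : k ≤ m)
    (hcomm : Commute (K ∙ p m) (initialSpan K p k)) :
    (K ∙ p m) * initialSpan K p k * (K ∙ p m) ≤ doubleCosets K p m := by
  rw [hcomm.eq, mul_assoc, hp.span_mul_self]
  calc initialSpan K p k * (K ∙ p m)
    _ ≤ initialSpan K p m * (K ∙ p m) * 1 := by
        rw [mul_one]; exact mul_le_mul_left (initialSpan_mono hkm) _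
    _ ≤ initialSpan K p m * (K ∙ p m) * initialSpan K p m :=
        mul_le_mul_right one_le_initialSpan _
    _ ≤ doubleCosets K p m := mul_span_mul_le_doubleCosets

theorem span_succ_mul_span_mul_span_succ_le (hp : IsHeckeSequence p) :
    (K ∙ p (m + 1)) * (K ∙ p m) * (K ∙ p (m + 1)) ≤ doubleCosets K p (m + 1) := by
  simp only [span_mul_span, Set.singleton_mul_singleton, span_singleton_le_iff_mem]
  rcases m.eq_zero_or_pos with rfl | hm
  · refine mul_span_palindrome_le_doubleCosets ?_
    simpa only [one_mul, palindrome] using mul_mem_mul (one_le.1 one_le_initialSpan)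
      (mem_span_singleton_self (palindrome p 1))
  · rw [← hp.braid m hm]
    have hpm : p m ∈ initialSpan K p (m + 1) := mem_initialSpan m.lt_succ_self
    exact mul_span_mul_le_doubleCosets
      (mul_mem_mul (mul_mem_mul hpm (mem_span_singleton_self _)) hpm)

theorem span_succ_mul_doubleCosets_mul_span_succ_le (hp : IsHeckeSequence p) :
    (K ∙ p (m + 1)) * doubleCosets K p m * (K ∙ p (m + 1)) ≤ doubleCosets K p (m + 1) := by
  have hA : initialSpan K p m ≤ initialSpan K p (m + 1) := initialSpan_mono m.le_succ
  have hcomm : Commute (K ∙ p (m + 1)) (initialSpan K p m) :=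
    commute_span_initialSpan fun j hj => (hp.comm j (m + 1) (by omega)).symm
  nth_rw 1 [doubleCosets]
  simp only [mul_add, add_mul]
  refine sup_le (sup_le (hp.span_mul_initialSpan_mul_span_le m.le_succ hcomm) ?_) ?_
  · calc (K ∙ p (m + 1)) * (initialSpan K p m * (K ∙ p m) * initialSpan K p m) * (K ∙ p (m + 1))
      _ = initialSpan K p m * ((K ∙ p (m + 1)) * (K ∙ p m) * (K ∙ p (m + 1))) *
            initialSpan K p m := by
          simp only [mul_assoc, ← hcomm.eq]; simp only [← mul_assoc, hcomm.eq]
      _ ≤ initialSpan K p (m + 1) * doubleCosets K p (m + 1) * initialSpan K p (m + 1) :=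
          mul_le_mul' (mul_le_mul' hA hp.span_succ_mul_span_mul_span_succ_le) hA
      _ = doubleCosets K p (m + 1) := by
          rw [initialSpan_mul_doubleCosets, hp.doubleCosets_mul_initialSpan]
  · calc (K ∙ p (m + 1)) * (initialSpan K p m * (K ∙ palindrome p m)) * (K ∙ p (m + 1))
      _ = initialSpan K p m * (K ∙ palindrome p (m + 1)) := by
          rw [← mul_assoc, hcomm.eq, mul_assoc, mul_assoc]
          simp only [span_mul_span, Set.singleton_mul_singleton, palindrome, mul_assoc]
      _ ≤ initialSpan K p (m + 1) * (K ∙ palindrome p (m + 1)) := mul_le_mul_left hA _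
      _ ≤ doubleCosets K p (m + 1) := mul_span_palindrome_le_doubleCosets

theorem initialSpan_succ (hp : IsHeckeSequence p) (m : ℕ) :
    initialSpan K p (m + 1) = doubleCosets K p m := by
  induction m with
  | zero =>
    exact hp.initialSpan_succ_of_span_mul_le <|
      hp.span_mul_initialSpan_mul_span_le le_rfl (commute_span_initialSpan (by simp))
  | succ m ih =>
    refine hp.initialSpan_succ_of_span_mul_le ?_
    rw [ih]
    exact hp.span_succ_mul_doubleCosets_mul_span_succ_le

theorem fg_initialSpan (hp : IsHeckeSequence p) (m : ℕ) : (initialSpan K p m).FG := by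
  induction m with
  | zero => simpa [initialSpan] using Subalgebra.fg_bot_toSubmodule (R := K) (A := R)
  | succ m ih =>
    rw [hp.initialSpan_succ]
    exact (ih.sup ((ih.mul (fg_span_singleton _)).mul ih)).sup (ih.mul (fg_span_singleton _))

end IsHeckeSequence

end DoubleCosets

variable {n : ℕ}

theorem adjoin_range_gen : Algebra.adjoin ℂ (Set.range (gen : Fin n → HeckeB n)) = ⊤ := by
  have h : Set.range (gen : Fin n → HeckeB n) =
      RingQuot.mkAlgHom ℂ (HeckeRel n) '' Set.range (FreeAlgebra.ι ℂ) := by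
    rw [← Set.range_comp]; rfl
  rw [h, ← AlgHom.map_adjoin, FreeAlgebra.adjoin_range_ι, Algebra.map_top]
  exact (AlgHom.range_eq_top _).2 (RingQuot.mkAlgHom_surjective ℂ _)

/-- The generators of `H_n^B(0)`, extended by zero to an infinite sequence. -/
noncomputable def genSeq (n : ℕ) (i : ℕ) : HeckeB n := if h : i < n then gen ⟨i, h⟩ else 0

theorem isHeckeSequence_genSeq (n : ℕ) : IsHeckeSequence (genSeq n) where
  sq i := by
    unfold genSeq gen
    split_ifs with h
    · simpa using RingQuot.mkAlgHom_rel ℂ (HeckeRel.sq ⟨i, h⟩)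
    · simp
  comm i j hij := by
    unfold genSeq gen Commute SemiconjBy
    split_ifs with h h'
    · simpa using RingQuot.mkAlgHom_rel ℂ (HeckeRel.comm ⟨i, h⟩ ⟨j, h'⟩ hij)
    all_goals simp
  braid i hi := by
    unfold genSeq gen
    split_ifs with h h'
    · simpa using RingQuot.mkAlgHom_rel ℂ (HeckeRel.braid ⟨i, h⟩ ⟨i + 1, h'⟩ hi rfl)
    all_goals simp
  braidFour := by
    unfold genSeq gen
    split_ifs with h h'
    · simpa using RingQuot.mkAlgHom_rel ℂ (HeckeRel.braidFour ⟨0, h⟩ ⟨1, h'⟩ rfl rfl)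
    all_goals simp

instance finite_heckeB (n : ℕ) : Module.Finite ℂ (HeckeB n) := by
  have hle : Algebra.adjoin ℂ (Set.range (gen : Fin n → HeckeB n)) ≤
      Algebra.adjoin ℂ (genSeq n '' Set.Iio n) :=
    Algebra.adjoin_mono (Set.range_subset_iff.2 fun i => ⟨i, i.2, by simp [genSeq]⟩)
  have hfg := (isHeckeSequence_genSeq n).fg_initialSpan (K := ℂ) n
  rw [initialSpan, top_le_iff.1 (adjoin_range_gen.symm.le.trans hle), Algebra.top_toSubmodule]
    at hfg
  exact ⟨hfg⟩

instance isNoetherianRing_heckeB (n : ℕ) : IsNoetherianRing (HeckeB n) :=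
  IsNoetherianRing.of_finite ℂ (HeckeB n)

/-! ### Type-`B` fundamental quasisymmetric functions -/

theorem coeff_FB (I : Finset (Fin n)) (m : ℕ →₀ ℕ) :
    MvPowerSeries.coeff m (FB I) = (Nat.card {i : Fin (n + 1) → ℕ // i 0 = 0 ∧ Monotone i ∧
      (∀ j ∈ I, i j.castSucc < i j.succ) ∧
      ∑ k : Fin n, Finsupp.single (i k.succ) 1 = m} : ℂ) := rfl

theorem mapDomain_sum_single {ι α β : Type*} (s : Finset ι) (i : ι → α) (φ : α → β) :
    (∑ k ∈ s, Finsupp.single (i k) 1 : α →₀ ℕ).mapDomain φ =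
      ∑ k ∈ s, Finsupp.single (φ (i k)) 1 := by
  simp only [Finsupp.mapDomain_finsetSum, Finsupp.mapDomain_single]

theorem mem_range_of_sum_single_eq_mapDomain {ι α β : Type*} {s : Finset ι} {i : ι → β}
    {φ : α → β} {m : α →₀ ℕ} (h : ∑ k ∈ s, Finsupp.single (i k) 1 = m.mapDomain φ) {k : ι}
    (hk : k ∈ s) : i k ∈ Set.range φ := by
  classical
  have hsupp : i k ∈ (m.mapDomain φ).support := by
    rw [← h, Finsupp.mem_support_iff, Finsupp.finsetSum_apply]
    exact (Finset.sum_pos' (fun _ _ => Nat.zero_le _) ⟨k, hk, by simp⟩).ne'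
  obtain ⟨a, -, ha⟩ := Finset.mem_image.1 (Finsupp.mapDomain_support hsupp)
  exact ⟨a, ha⟩

theorem coeff_mapDomain_FB (I : Finset (Fin n)) {φ : ℕ → ℕ} (hφ : StrictMono φ) (h0 : φ 0 = 0)
    (m : ℕ →₀ ℕ) :
    MvPowerSeries.coeff (m.mapDomain φ) (FB I) = MvPowerSeries.coeff m (FB I) := by
  rw [coeff_FB, coeff_FB]
  congr 1
  symm
  refine Nat.card_congr (Equiv.ofBijective (fun i => ⟨φ ∘ i.1, ?_⟩) ⟨?_, ?_⟩)
  · obtain ⟨i, hi0, hmono, hlt, hsum⟩ := i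
    refine ⟨by simp [hi0, h0], hφ.monotone.comp hmono, fun j hj => hφ (hlt j hj), ?_⟩
    simp only [Function.comp_apply, ← mapDomain_sum_single, hsum]
  · intro i i' h
    exact Subtype.ext (hφ.injective.comp_left (congrArg Subtype.val h))
  · rintro ⟨i, hi0, hmono, hlt, hsum⟩
    have hrange : ∀ k, i k ∈ Set.range φ :=
      Fin.cases ⟨0, by rw [h0, hi0]⟩ fun k =>
        mem_range_of_sum_single_eq_mapDomain hsum (Finset.mem_univ k)
    choose i' hi' using hrange
    obtain rfl : φ ∘ i' = i := funext hi'
    refine ⟨⟨i', hφ.injective (by rw [h0]; exact hi0), fun a b hab => hφ.le_iff_le.1 (hmono hab),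
      fun j hj => hφ.lt_iff_lt.1 (hlt j hj), ?_⟩, rfl⟩
    refine Finsupp.mapDomain_injective hφ.injective ?_
    rw [mapDomain_sum_single, ← hsum]
    rfl

theorem FB_mem_QSymB (I : Finset (Fin n)) : FB I ∈ QSymB := by
  refine ⟨⟨n, fun m hm => ?_⟩, fun φ hφ h0 m => coeff_mapDomain_FB I hφ h0 m⟩
  rw [coeff_FB, Nat.cast_ne_zero] at hm
  obtain ⟨⟨i, -, -, -, rfl⟩⟩ := (Nat.card_ne_zero.1 hm).1
  simp [Finsupp.degree_single]

/-! ### Traces and the characteristic -/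

theorem trace_eq_add_of_exact {K A B C : Type*} [CommRing K] [AddCommGroup A] [Module K A]
    [AddCommGroup B] [Module K B] [AddCommGroup C] [Module K C] [Module.Free K A]
    [Module.Finite K A] [Module.Free K B] [Module.Finite K B] [Module.Free K C]
    [Module.Finite K C] {f : A →ₗ[K] B} {g : B →ₗ[K] C} (hf : Function.Injective f)
    (hfg : Function.Exact f g) (hg : Function.Surjective g) {a : Module.End K A}
    {b : Module.End K B} {c : Module.End K C} (hab : b ∘ₗ f = f ∘ₗ a) (hbc : g ∘ₗ b = c ∘ₗ g) :
    LinearMap.trace K B b = LinearMap.trace K A a + LinearMap.trace K C c := by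
  obtain ⟨s, hgs⟩ := Module.projective_lifting_property g LinearMap.id hg
  obtain ⟨e, hef, hge⟩ := hfg.splitSurjectiveEquiv hf ⟨s, hgs⟩
  let r := LinearMap.fst K A C ∘ₗ e.toLinearMap
  let s' := e.symm.toLinearMap ∘ₗ LinearMap.inr K A C
  have hrf : r ∘ₗ f = LinearMap.id := by ext x; simp [r, hef]
  have hgs' : g ∘ₗ s' = LinearMap.id := by ext x; simp [s', hge]
  have hid : f ∘ₗ r + s' ∘ₗ g = LinearMap.id := by
    ext x
    refine e.injective ?_
    simp [r, s', hef, hge]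
  calc LinearMap.trace K B b = LinearMap.trace K B (b ∘ₗ (f ∘ₗ r + s' ∘ₗ g)) := by
        rw [hid, LinearMap.comp_id]
    _ = LinearMap.trace K B ((f ∘ₗ a) ∘ₗ r) + LinearMap.trace K B ((b ∘ₗ s') ∘ₗ g) := by
        rw [LinearMap.comp_add, map_add, ← hab]; rfl
    _ = LinearMap.trace K A (r ∘ₗ f ∘ₗ a) + LinearMap.trace K C (g ∘ₗ b ∘ₗ s') := by
        rw [LinearMap.trace_comp_comm' r (f ∘ₗ a), LinearMap.trace_comp_comm' g (b ∘ₗ s')]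
    _ = LinearMap.trace K A a + LinearMap.trace K C c := by
        rw [← LinearMap.comp_assoc, hrf, LinearMap.id_comp, ← LinearMap.comp_assoc, hbc,
          LinearMap.comp_assoc, hgs', LinearMap.comp_id]

namespace FGMod

noncomputable instance moduleComplex (M : FGMod n) : Module ℂ M.carrier :=
  Module.compHom M.carrier (algebraMap ℂ (HeckeB n))

instance isScalarTower (M : FGMod n) : IsScalarTower ℂ (HeckeB n) M.carrier where
  smul_assoc c a v := by
    rw [Algebra.smul_def, mul_smul]
    rfl

instance finiteDimensional (M : FGMod n) : FiniteDimensional ℂ M.carrier :=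
  Module.Finite.trans (HeckeB n) M.carrier

/-- The trace of an element of `H_n^B(0)` acting on a finitely generated module. -/
noncomputable def trace (M : FGMod n) (a : HeckeB n) : ℂ :=
  LinearMap.trace ℂ M.carrier (Algebra.lsmul ℂ ℂ M.carrier a)

theorem trace_eq_add_of_exact {A B C : FGMod n} {f : A.carrier →ₗ[HeckeB n] B.carrier}
    {g : B.carrier →ₗ[HeckeB n] C.carrier} (hf : Function.Injective f)
    (hfg : Function.Exact f g) (hg : Function.Surjective g) (a : HeckeB n) :
    B.trace a = A.trace a + C.trace a := by
  refine DominoHecke.trace_eq_add_of_exact (f := f.restrictScalars ℂ) (g := g.restrictScalars ℂ)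
    hf hfg hg ?_ ?_
  · ext x; exact (f.map_smul a x).symm
  · ext x; exact g.map_smul a x

theorem trace_eq_of_linearEquiv (M : FGMod n) {V : Type*} [AddCommGroup V] [Module ℂ V]
    [Module (HeckeB n) V] [IsScalarTower ℂ (HeckeB n) V] (e : M.carrier ≃ₗ[HeckeB n] V)
    (a : HeckeB n) : M.trace a = LinearMap.trace ℂ V (Algebra.lsmul ℂ ℂ V a) := by
  rw [trace, ← LinearMap.trace_conj' _ (e.restrictScalars ℂ)]
  congr 1
  ext v
  simp [LinearEquiv.conj_apply]

end FGMod

@[simp]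
theorem simpleChar_gen (I : Finset (Fin n)) (j : Fin n) :
    simpleChar I (gen j) = if j ∈ I then -1 else 0 := by
  simp [simpleChar, gen]

theorem smul_simpleB (I : Finset (Fin n)) (a : HeckeB n) (c : SimpleB I) :
    a • c = simpleChar I a • c := rfl

theorem trace_simpleB (I : Finset (Fin n)) (a : HeckeB n) :
    (FGMod.mk (SimpleB I)).trace a = simpleChar I a := by
  have hsmul : Algebra.lsmul ℂ ℂ (SimpleB I) a = simpleChar I a • LinearMap.id :=
    LinearMap.ext (smul_simpleB I a)
  rw [FGMod.trace_eq_of_linearEquiv _ (LinearEquiv.refl (HeckeB n) (SimpleB I)), hsmul]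
  change LinearMap.trace ℂ ℂ (simpleChar I a • (LinearMap.id : ℂ →ₗ[ℂ] ℂ)) = _
  simp

/-- An element of `H_n^B(0)` acting as `1` on `S_I^B` and as `0` on the other simple modules. -/
noncomputable def selector (I : Finset (Fin n)) : HeckeB n :=
  (List.ofFn fun j => if j ∈ I then -gen j else 1 + gen j).prod

theorem simpleChar_selector (I J : Finset (Fin n)) :
    simpleChar J (selector I) = if I = J then 1 else 0 := by
  have simpleChar_factor : ∀ j : Fin n,
      simpleChar J (if j ∈ I then -gen j else 1 + gen j) = if j ∈ I ↔ j ∈ J then 1 else 0 := by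
    intro j
    by_cases hI : j ∈ I <;> by_cases hJ : j ∈ J <;> simp [hI, hJ]
  rw [selector, map_list_prod, List.map_ofFn, List.prod_ofFn]
  simp only [Function.comp_apply, simpleChar_factor, Finset.prod_ite_zero, Finset.prod_const_one,
    Finset.mem_univ, true_imp_iff, Finset.ext_iff]

/-- The type-`B` quasisymmetric characteristic, as a combination of traces: on a module with a
composition series by simple modules `S_J^B`, the trace of `selector I` counts the factors
isomorphic to `S_I^B`. -/
noncomputable def characteristic (n : ℕ) : G0 n →+ QSymB :=
  QuotientAddGroup.lift _
    (FreeAbelianGroup.lift fun M : FGMod n =>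
      ∑ I : Finset (Fin n), M.trace (selector I) • (⟨FB I, FB_mem_QSymB I⟩ : QSymB)) <| by
    rw [AddSubgroup.closure_le]
    rintro _ ⟨A, B, C, f, g, hf, hfg, hg, rfl⟩
    simp only [SetLike.mem_coe, AddMonoidHom.mem_ker, map_add, map_sub,
      FreeAbelianGroup.lift_apply_of, ← Finset.sum_sub_distrib, ← Finset.sum_add_distrib]
    refine Finset.sum_eq_zero fun I _ => ?_
    rw [FGMod.trace_eq_add_of_exact hf hfg hg, add_smul]
    abel

theorem isCharB_characteristic (n : ℕ) : IsCharB (characteristic n) := by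
  intro J
  have characteristic_cls : characteristic n (G0.cls n (SimpleB J)) =
      ∑ I : Finset (Fin n), (FGMod.mk (SimpleB J)).trace (selector I) •
        (⟨FB I, FB_mem_QSymB I⟩ : QSymB) := FreeAbelianGroup.lift_apply_of _ _
  rw [characteristic_cls]
  simp [trace_simpleB, simpleChar_selector]

/-! ### Classes of modules with a triangular basis -/

theorem G0.cls_eq_add_of_exact {A B C : Type} [AddCommGroup A] [Module (HeckeB n) A]
    [Module.Finite (HeckeB n) A] [AddCommGroup B] [Module (HeckeB n) B]
    [Module.Finite (HeckeB n) B] [AddCommGroup C] [Module (HeckeB n) C]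
    [Module.Finite (HeckeB n) C] {f : A →ₗ[HeckeB n] B} {g : B →ₗ[HeckeB n] C}
    (hf : Function.Injective f) (hfg : Function.Exact f g) (hg : Function.Surjective g) :
    G0.cls n B = G0.cls n A + G0.cls n C := by
  have h : G0.cls n A - G0.cls n B + G0.cls n C = 0 :=
    (QuotientAddGroup.eq_zero_iff _).2
      (AddSubgroup.subset_closure ⟨FGMod.mk A, FGMod.mk B, FGMod.mk C, f, g, hf, hfg, hg, rfl⟩)
  rw [← sub_eq_zero, ← neg_eq_zero, ← h]
  abel

theorem G0.cls_of_subsingleton (A : Type) [AddCommGroup A] [Module (HeckeB n) A]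
    [Module.Finite (HeckeB n) A] [Subsingleton A] : G0.cls n A = 0 :=
  left_eq_add.1 <| G0.cls_eq_add_of_exact (f := (LinearMap.id : A →ₗ[HeckeB n] A))
    (g := (LinearMap.id : A →ₗ[HeckeB n] A)) Function.injective_id
    (fun y => by simp [Subsingleton.elim y 0]) Function.surjective_id

theorem G0.cls_congr {A B : Type} [AddCommGroup A] [Module (HeckeB n) A]
    [Module.Finite (HeckeB n) A] [AddCommGroup B] [Module (HeckeB n) B]
    [Module.Finite (HeckeB n) B] (e : A ≃ₗ[HeckeB n] B) : G0.cls n A = G0.cls n B := by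
  rw [G0.cls_eq_add_of_exact (f := e.toLinearMap) (g := (0 : B →ₗ[HeckeB n] PUnit)) e.injective
    (fun y => by simp) (fun y => ⟨0, rfl⟩), G0.cls_of_subsingleton PUnit, add_zero]

section AdjoinEqTop

variable {K R M N : Type*} [CommSemiring K] [Semiring R] [Algebra K R] [AddCommMonoid M]
  [Module K M] [Module R M] [IsScalarTower K R M] [AddCommMonoid N] [Module K N] [Module R N]
  [IsScalarTower K R N] {s : Set R}

theorem smul_mem_of_adjoin_eq_top (hs : Algebra.adjoin K s = ⊤) {p : Submodule K M}
    (hp : ∀ r ∈ s, ∀ x ∈ p, r • x ∈ p) (r : R) {x : M} (hx : x ∈ p) : r • x ∈ p := by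
  induction (hs ▸ Algebra.mem_top : r ∈ Algebra.adjoin K s) using Algebra.adjoin_induction
    generalizing x with
  | mem r hr => exact hp r hr x hx
  | algebraMap c => rw [algebraMap_smul]; exact p.smul_mem c hx
  | add r r' _ _ ihr ihr' => rw [add_smul]; exact p.add_mem (ihr hx) (ihr' hx)
  | mul r r' _ _ ihr ihr' => rw [mul_smul]; exact ihr (ihr' hx)

theorem map_smul_of_adjoin_eq_top (hs : Algebra.adjoin K s = ⊤) {f : M →ₗ[K] N}
    (hf : ∀ r ∈ s, ∀ x, f (r • x) = r • f x) (r : R) (x : M) : f (r • x) = r • f x := by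
  induction (hs ▸ Algebra.mem_top : r ∈ Algebra.adjoin K s) using Algebra.adjoin_induction
    generalizing x with
  | mem r hr => exact hf r hr x
  | algebraMap c => rw [algebraMap_smul, algebraMap_smul, map_smul]
  | add r r' _ _ ihr ihr' => rw [add_smul, add_smul, map_add, ihr, ihr']
  | mul r r' _ _ ihr ihr' => rw [mul_smul, mul_smul, ihr, ihr']

end AdjoinEqTop

section Triangular

variable {ι α : Type*} {M : Type} [LinearOrder α] [AddCommGroup M] [Module ℂ M]
  [Module (HeckeB n) M]

open Submodule in
/-- Each generator `π_i` acts on the basis vector `b t` by `-1` or `0`, according to whether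
`i ∈ D t`, up to basis vectors at which `h` is larger. -/
def IsTriangular (b : Module.Basis ι ℂ M) (D : ι → Finset (Fin n)) (h : ι → α) : Prop :=
  ∀ i t, gen i • b t - (if i ∈ D t then -1 else 0 : ℂ) • b t ∈ span ℂ (b '' {t' | h t < h t'})

namespace IsTriangular

open Submodule

variable {b : Module.Basis ι ℂ M} {D : ι → Finset (Fin n)} {h : ι → α} {S : Set ι}
  [IsScalarTower ℂ (HeckeB n) M]

theorem gen_smul_mem_span (H : IsTriangular b D h) (hS : ∀ t ∈ S, ∀ t', h t < h t' → t' ∈ S)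
    (i : Fin n) {v : M} (hv : v ∈ span ℂ (b '' S)) : gen i • v ∈ span ℂ (b '' S) := by
  have hle : span ℂ (b '' S) ≤ (span ℂ (b '' S)).comap (Algebra.lsmul ℂ ℂ M (gen i)) := by
    rw [span_le]
    rintro _ ⟨t, ht, rfl⟩
    have hmem := add_mem (span_mono (Set.image_mono (hS t ht)) (H i t))
      (smul_mem _ (if i ∈ D t then -1 else 0 : ℂ) (subset_span (Set.mem_image_of_mem b ht)))
    rw [sub_add_cancel] at hmem
    exact hmem
  exact hle hv

theorem restrictScalars_span (H : IsTriangular b D h)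
    (hS : ∀ t ∈ S, ∀ t', h t < h t' → t' ∈ S) :
    (span (HeckeB n) (b '' S)).restrictScalars ℂ = span ℂ (b '' S) := by
  refine le_antisymm (fun v hv => ?_) (span_le_restrictScalars ℂ (HeckeB n) _)
  refine span_induction (fun x hx => subset_span hx) (zero_mem _) (fun x y _ _ => add_mem)
    (fun a x _ hx => ?_) hv
  exact smul_mem_of_adjoin_eq_top adjoin_range_gen
    (Set.forall_mem_range.2 fun i x => H.gen_smul_mem_span hS i) a hx

theorem mem_span_iff (H : IsTriangular b D h) (hS : ∀ t ∈ S, ∀ t', h t < h t' → t' ∈ S) {v : M} :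
    v ∈ span (HeckeB n) (b '' S) ↔ ∀ t, b.coord t v ≠ 0 → t ∈ S := by
  rw [← restrictScalars_mem ℂ, H.restrictScalars_span hS, b.mem_span_image]
  simp [Set.subset_def]

theorem coord_gen_smul (H : IsTriangular b D h) {t : ι} (ht : ∀ s ∈ S, h t ≤ h s) (i : Fin n)
    {v : M} (hv : v ∈ span ℂ (b '' S)) :
    b.coord t (gen i • v) = (if i ∈ D t then -1 else 0) * b.coord t v := by
  have hle : span ℂ (b '' S) ≤ LinearMap.eqLocus (b.coord t ∘ₗ Algebra.lsmul ℂ ℂ M (gen i))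
      ((if i ∈ D t then -1 else 0 : ℂ) • b.coord t) := by
    rw [span_le]
    rintro _ ⟨s, hs, rfl⟩
    have hzero : b.coord t (gen i • b s - (if i ∈ D s then -1 else 0 : ℂ) • b s) = 0 := by
      by_contra hne
      exact (ht s hs).not_gt (b.mem_span_image.1 (H i s) (Finsupp.mem_support_iff.2 hne))
    rw [map_sub, sub_eq_zero, LinearMap.map_smul] at hzero
    change b.coord t (gen i • b s) = (if i ∈ D t then -1 else 0 : ℂ) * b.coord t (b s)
    rw [hzero]
    obtain rfl | hst := eq_or_ne s t
    · rfl
    · simp [hst]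
  exact hle hv

/-- The coordinate at an index minimizing `h`, as a map to a simple module. -/
noncomputable def coordMap (H : IsTriangular b D h) (hS : ∀ t ∈ S, ∀ t', h t < h t' → t' ∈ S)
    {t : ι} (ht : ∀ s ∈ S, h t ≤ h s) : span (HeckeB n) (b '' S) →ₗ[HeckeB n] SimpleB (D t) where
  toFun v := b.coord t v.1
  map_add' v w := map_add (b.coord t) v.1 w.1
  map_smul' := by
    let f : span (HeckeB n) (b '' S) →ₗ[ℂ] SimpleB (D t) :=
      b.coord t ∘ₗ (span (HeckeB n) (b '' S)).subtype.restrictScalars ℂ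
    refine map_smul_of_adjoin_eq_top (f := f) adjoin_range_gen
      (Set.forall_mem_range.2 fun i v => ?_)
    rw [smul_simpleB, simpleChar_gen]
    exact H.coord_gen_smul ht i (H.restrictScalars_span hS ▸ v.2)

theorem coordMap_surjective (H : IsTriangular b D h) (hS : ∀ t ∈ S, ∀ t', h t < h t' → t' ∈ S)
    {t : ι} (ht : ∀ s ∈ S, h t ≤ h s) (htS : t ∈ S) : Function.Surjective (H.coordMap hS ht) := by
  intro (c : ℂ)
  have hmem : b t ∈ span (HeckeB n) (b '' S) := subset_span (Set.mem_image_of_mem b htS)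
  refine ⟨c • ⟨b t, hmem⟩, ?_⟩
  change b.coord t (c • b t) = c
  rw [map_smul, b.coord_apply, b.repr_self, Finsupp.single_eq_same, smul_eq_mul, mul_one]

theorem cls_span [Module.Finite (HeckeB n) M] (H : IsTriangular b D h) (S : Finset ι)
    (hS : ∀ t ∈ S, ∀ t', h t < h t' → t' ∈ S) :
    G0.cls n (span (HeckeB n) (b '' S)) = ∑ t ∈ S, G0.cls n (SimpleB (D t)) := by
  classical
  induction S using Finset.induction_on_min_value h with
  | empty =>
    have : Subsingleton (span (HeckeB n) (b '' ((∅ : Finset ι) : Set ι))) := by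
      rw [Finset.coe_empty, Set.image_empty, span_empty]
      infer_instance
    rw [G0.cls_of_subsingleton, Finset.sum_empty]
  | insert t s hts hmin ih =>
    have ht : ∀ t' ∈ ((insert t s : Finset ι) : Set ι), h t ≤ h t' := by simpa using hmin
    have hs : ∀ t' ∈ s, ∀ t'', h t' < h t'' → t'' ∈ s := fun t' ht' t'' hlt =>
      (Finset.mem_insert.1 (hS t' (Finset.mem_insert_of_mem ht') t'' hlt)).resolve_left
        fun heq => ((hmin t' ht').trans_lt hlt).ne (heq ▸ rfl)
    have hmem : ∀ v ∈ span (HeckeB n) (b '' (insert t s : Finset ι)),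
        b.coord t v = 0 ↔ v ∈ span (HeckeB n) (b '' s) := by
      intro v hv
      rw [H.mem_span_iff hs]
      rw [H.mem_span_iff hS] at hv
      refine ⟨fun h0 t' ht' => ?_, fun hsub => by_contra fun hne => hts (hsub t hne)⟩
      exact (Finset.mem_insert.1 (hv t' ht')).resolve_left fun heq => ht' (heq ▸ h0)
    rw [Finset.sum_insert hts, ← ih hs, add_comm]
    refine G0.cls_eq_add_of_exact (g := H.coordMap hS ht) (inclusion_injective
      (span_mono (Set.image_mono (Finset.coe_subset.2 (Finset.subset_insert t s))))) ?_ ?_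
    · intro v
      refine (hmem v.1 v.2).trans ⟨fun hv => ⟨⟨v.1, hv⟩, rfl⟩, ?_⟩
      rintro ⟨w, rfl⟩
      exact w.2
    · exact H.coordMap_surjective hS ht (Finset.mem_insert_self t s)

theorem cls_eq_sum [Module.Finite (HeckeB n) M] [Fintype ι] (H : IsTriangular b D h) :
    G0.cls n M = ∑ t, G0.cls n (SimpleB (D t)) := by
  have htop : span (HeckeB n) (b '' (Finset.univ : Finset ι)) = ⊤ := by
    rw [← restrictScalars_eq_top_iff ℂ, H.restrictScalars_span (by simp)]
    simp [b.span_eq]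
  rw [← H.cls_span Finset.univ (by simp)]
  exact G0.cls_congr ((LinearEquiv.ofTop _ htop).symm)

end IsTriangular

end Triangular

/-! ### Sorting operators on words -/

section Words

variable {K κ α : Type*} [Ring K] [DecidableEq κ] (r : α → α → Prop)

open Classical in
/-- The 0-Hecke operator on formal combinations of words that sorts the letters in positions
`j` and `i`: it exchanges them if the one at `i` is smaller, acts by `-1` if the one at `j` is
smaller, and kills the word if they are incomparable. -/
noncomputable def sortOp (K : Type*) [Ring K] (j i : κ) : Module.End K ((κ → α) →₀ K) :=
  Finsupp.linearCombination K fun w =>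
    if r (w j) (w i) then -Finsupp.single w 1
    else if r (w i) (w j) then Finsupp.single (w ∘ Equiv.swap j i) 1 else 0

variable {r} {j i : κ} {w : κ → α}

open Classical in
theorem sortOp_single (w : κ → α) : sortOp r K j i (Finsupp.single w 1) =
    if r (w j) (w i) then -Finsupp.single w 1
    else if r (w i) (w j) then Finsupp.single (w ∘ Equiv.swap j i) 1 else 0 := by
  simp [sortOp]

theorem sortOp_of_rel (h : r (w j) (w i)) :
    sortOp r K j i (Finsupp.single w 1) = -Finsupp.single w 1 := by
  simp [sortOp_single, h]

theorem sortOp_of_rel_swap [Std.Asymm r] (h : r (w i) (w j)) :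
    sortOp r K j i (Finsupp.single w 1) = Finsupp.single (w ∘ Equiv.swap j i) 1 := by
  simp [sortOp_single, h, asymm h]

theorem sortOp_of_not_rel (h : ¬r (w j) (w i)) (h' : ¬r (w i) (w j)) :
    sortOp r K j i (Finsupp.single w 1) = 0 := by
  simp [sortOp_single, h, h']

theorem commute_sortOp {j i l k : κ} (hjl : j ≠ l) (hjk : j ≠ k) (hil : i ≠ l) (hik : i ≠ k) :
    Commute (sortOp r K j i) (sortOp r K l k) := by
  refine Finsupp.lhom_ext' fun w => LinearMap.ext_ring ?_
  change sortOp r K j i (sortOp r K l k (Finsupp.single w 1)) =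
    sortOp r K l k (sortOp r K j i (Finsupp.single w 1))
  have hswap : (w ∘ Equiv.swap l k) ∘ Equiv.swap j i = (w ∘ Equiv.swap j i) ∘ Equiv.swap l k := by
    funext x
    simp only [Function.comp_apply, Equiv.swap_apply_def]
    grind
  by_cases h : r (w j) (w i) <;> by_cases h' : r (w i) (w j) <;>
    by_cases g : r (w l) (w k) <;> by_cases g' : r (w k) (w l) <;>
    simp [sortOp_single, Equiv.swap_apply_of_ne_of_ne, hjl, hjk, hil, hik, hjl.symm, hjk.symm,
      hil.symm, hik.symm, h, h', g, g', hswap]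

theorem braid_of_sort [IsStrictOrder α r] {M : Type*} [AddCommGroup M] [Module K M]
    {A B : Module.End K M} {v : α → α → α → M}
    (hA : ∀ x y z, A (v x y z) = open Classical in
      if r x y then -v x y z else if r y x then v y x z else 0)
    (hB : ∀ x y z, B (v x y z) = open Classical in
      if r y z then -v x y z else if r z y then v x z y else 0) (a b c : α) :
    A (B (A (v a b c))) = B (A (B (v a b c))) := by
  have trichotomy : ∀ x y, r x y ∧ ¬r y x ∨ ¬r x y ∧ r y x ∨ ¬r x y ∧ ¬r y x := fun x y => by
    have : r x y → ¬r y x := asymm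
    tauto
  have htrans : ∀ {x y z}, r x y → r y z → r x z := _root_.trans
  rcases trichotomy a b with ⟨_, _⟩ | ⟨_, _⟩ | ⟨_, _⟩ <;>
  rcases trichotomy b c with ⟨_, _⟩ | ⟨_, _⟩ | ⟨_, _⟩ <;>
  rcases trichotomy a c with ⟨_, _⟩ | ⟨_, _⟩ | ⟨_, _⟩ <;>
  first
  | simp [*]; done
  | exact absurd (htrans ‹r a b› ‹r b c›) ‹_›
  | exact absurd (htrans ‹r b a› ‹r a c›) ‹_›
  | exact absurd (htrans ‹r a c› ‹r c b›) ‹_›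

theorem sortOp_braid [IsStrictOrder α r] {a b c : κ} (hab : a ≠ b) (hac : a ≠ c) (hbc : b ≠ c) :
    sortOp r K a b * sortOp r K b c * sortOp r K a b =
      sortOp r K b c * sortOp r K a b * sortOp r K b c := by
  refine Finsupp.lhom_ext' fun w => LinearMap.ext_ring ?_
  let u (x y z : α) : κ → α :=
    Function.update (Function.update (Function.update w c z) b y) a x
  have swap_ab (x y z : α) : u x y z ∘ Equiv.swap a b = u y x z := by
    funext k
    simp only [Function.comp_apply, Equiv.swap_apply_def, u, Function.update_apply]
    grind
  have swap_bc (x y z : α) : u x y z ∘ Equiv.swap b c = u x z y := by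
    funext k
    simp only [Function.comp_apply, Equiv.swap_apply_def, u, Function.update_apply]
    grind
  have u_a (x y z : α) : u x y z a = x := by simp [u]
  have u_b (x y z : α) : u x y z b = y := by simp [u, hab.symm]
  have u_c (x y z : α) : u x y z c = z := by simp [u, hac.symm, hbc.symm]
  have hw : u (w a) (w b) (w c) = w := by simp [u]
  have h := braid_of_sort (r := r) (A := sortOp r K a b) (B := sortOp r K b c)
    (v := fun x y z => Finsupp.single (u x y z) (1 : K))
    (fun x y z => by rw [sortOp_single, swap_ab, u_a, u_b])
    (fun x y z => by rw [sortOp_single, swap_bc, u_b, u_c]) (w a) (w b) (w c)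
  simp only [hw] at h
  exact h

end Words

/-! ### Geometry of standard domino tableaux -/

variable {μ : YoungDiagram}

/-- The domino `d` lies strictly above the domino `e`. Nonemptiness is required in order that
this be a strict order on all finite sets of cells. -/
def IsAbove (d e : Finset (ℕ × ℕ)) : Prop :=
  d.Nonempty ∧ e.Nonempty ∧ ∀ a ∈ d, ∀ b ∈ e, a.1 < b.1

instance : IsStrictOrder (Finset (ℕ × ℕ)) IsAbove where
  irrefl := by
    rintro d ⟨⟨a, ha⟩, -, h⟩
    exact lt_irrefl _ (h a ha a ha)
  trans := by
    rintro d e f ⟨hd, ⟨b, hb⟩, h⟩ ⟨-, hf, h'⟩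
    exact ⟨hd, hf, fun a ha c hc => (h a ha b hb).trans (h' b hb c hc)⟩

theorem IsAbove.sup_fst_lt {d e : Finset (ℕ × ℕ)} (h : IsAbove d e) :
    d.sup Prod.fst < e.sup Prod.fst := by
  obtain ⟨hd, ⟨b, hb⟩, h⟩ := h
  obtain ⟨a, ha, hsup⟩ := Finset.exists_mem_eq_sup d hd Prod.fst
  rw [hsup]
  exact (h a ha b hb).trans_le (Finset.le_sup (f := Prod.fst) hb)

theorem nonempty_of_isDomino {d : Finset (ℕ × ℕ)} (hd : IsHorizontal d ∨ IsVertical d) :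
    d.Nonempty := by
  rcases hd with ⟨r, c, rfl⟩ | ⟨r, c, rfl⟩ <;> exact Finset.insert_nonempty _ _

theorem exists_fst_eq_of_not_isAbove {d e : Finset (ℕ × ℕ)} (hd : IsHorizontal d ∨ IsVertical d)
    (he : IsHorizontal e ∨ IsVertical e) (h : ¬IsAbove d e) (h' : ¬IsAbove e d) :
    ∃ a ∈ d, ∃ b ∈ e, a.1 = b.1 := by
  by_contra! hne
  simp only [IsAbove, nonempty_of_isDomino hd, nonempty_of_isDomino he, true_and, not_forall,
    not_lt] at h h'
  rcases hd with ⟨r, c, rfl⟩ | ⟨r, c, rfl⟩ <;> rcases he with ⟨s, t, rfl⟩ | ⟨s, t, rfl⟩ <;>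
    simp at h h' hne <;> omega

theorem IsVertical.eq_of_origin_mem {d : Finset (ℕ × ℕ)} (hd : IsVertical d)
    (h0 : (0, 0) ∈ d) : d = {(0, 0), (1, 0)} := by
  obtain ⟨r, c, rfl⟩ := hd
  simp only [Finset.mem_insert, Finset.mem_singleton, Prod.mk.injEq] at h0
  obtain ⟨rfl, rfl⟩ : r = 0 ∧ c = 0 := by omega
  rfl

theorem IsHorizontal.eq_of_origin_mem {d : Finset (ℕ × ℕ)} (hd : IsHorizontal d)
    (h0 : (0, 0) ∈ d) : d = {(0, 0), (0, 1)} := by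
  obtain ⟨r, c, rfl⟩ := hd
  simp only [Finset.mem_insert, Finset.mem_singleton, Prod.mk.injEq] at h0
  obtain ⟨rfl, rfl⟩ : r = 0 ∧ c = 0 := by omega
  rfl

theorem pred_val (i : Fin n) : (pred i).val = i.val - 1 := rfl

theorem pred_lt {i : Fin n} (hi : i.val ≠ 0) : pred i < i := by
  rw [Fin.lt_def, pred_val]
  omega

namespace SDT

theorem dom_injective : Function.Injective (dom : SDT μ n → _) := fun _ _ h => SDT.ext h

variable (T : SDT μ n)

theorem nonempty_dom (k : Fin n) : (T.dom k).Nonempty := nonempty_of_isDomino (T.isDomino k)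

theorem mem_cells {c : ℕ × ℕ} : c ∈ μ.cells ↔ ∃ k, c ∈ T.dom k := by
  simp [← T.cover]

theorem eq_of_mem {k l : Fin n} {c : ℕ × ℕ} (hk : c ∈ T.dom k) (hl : c ∈ T.dom l) : k = l :=
  by_contra fun h => Finset.disjoint_left.1 (T.disjoint k l h) hk hl

theorem le_of_mem {k l : Fin n} {a b : ℕ × ℕ} (ha : a ∈ T.dom k) (hb : b ∈ T.dom l)
    (h : a ≤ b) : k ≤ l := by
  have hcorner : (a.1, b.2) ∈ μ.cells :=
    μ.isLowerSet (show ((a.1, b.2) : ℕ × ℕ) ≤ b from ⟨h.1, le_rfl⟩) (T.mem_cells.2 ⟨l, hb⟩)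
  obtain ⟨m, hm⟩ := T.mem_cells.1 hcorner
  have hkm : k ≤ m := by
    rcases h.2.eq_or_lt with heq | hlt
    · exact (T.eq_of_mem ha ((Prod.ext rfl heq : a = (a.1, b.2)) ▸ hm)).le
    · exact T.row_le k m a ha _ hm rfl hlt
  have hml : m ≤ l := by
    rcases h.1.eq_or_lt with heq | hlt
    · exact (T.eq_of_mem hm ((Prod.ext heq.symm rfl : b = (a.1, b.2)) ▸ hb)).le
    · exact T.col_le m l _ hm b hb rfl hlt
  exact hkm.trans hml

/-- A standard domino tableau from a tiling by dominoes whose entries increase weakly for the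
product order on cells. -/
def ofMonotone (dom : Fin n → Finset (ℕ × ℕ)) (isDomino : ∀ k, IsHorizontal (dom k) ∨
    IsVertical (dom k)) (mem_cells : ∀ c, c ∈ μ.cells ↔ ∃ k, c ∈ dom k)
    (le : ∀ k l, ∀ a ∈ dom k, ∀ b ∈ dom l, a ≤ b → k ≤ l) : SDT μ n where
  dom := dom
  isDomino := isDomino
  disjoint k l hkl := Finset.disjoint_left.2 fun c hk hl =>
    hkl (le_antisymm (le k l c hk c hl le_rfl) (le l k c hl c hk le_rfl))
  cover := by
    ext c
    simp [mem_cells]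
  row_le k l a ha b hb hrow hcol := le k l a ha b hb ⟨hrow.le, hcol.le⟩
  col_le k l a ha b hb hcol hrow := le k l a ha b hb ⟨hrow.le, hcol.le⟩

theorem origin_mem {z : Fin n} (hz : z.val = 0) : (0, 0) ∈ T.dom z := by
  obtain ⟨b, hb⟩ := T.nonempty_dom z
  have h0b : ((0, 0) : ℕ × ℕ) ≤ b := ⟨b.1.zero_le, b.2.zero_le⟩
  obtain ⟨k, hk⟩ := T.mem_cells.1 (μ.isLowerSet h0b (T.mem_cells.2 ⟨z, hb⟩))
  obtain rfl : k = z := le_antisymm (T.le_of_mem hk hb h0b) (by rw [Fin.le_def]; omega)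
  exact hk

/-- Exchanging two consecutive entries, the larger of which lies strictly above. -/
def swap (i : Fin n) (hi : i.val ≠ 0) (h : IsAbove (T.dom i) (T.dom (pred i))) : SDT μ n :=
  ofMonotone (T.dom ∘ Equiv.swap (pred i) i) (fun _ => T.isDomino _)
    (fun _ => T.mem_cells.trans (Equiv.swap (pred i) i).exists_congr_right.symm) <| by
    intro k l a ha b hb hab
    have hle := T.le_of_mem ha hb hab
    by_contra! hlt
    obtain ⟨rfl, rfl⟩ : k = i ∧ l = pred i := by
      have := pred_val i
      simp only [Equiv.swap_apply_def, Fin.le_def, Fin.lt_def, Fin.ext_iff] at hle hlt ⊢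
      split_ifs at hle <;> omega
    simp only [Function.comp_apply, Equiv.swap_apply_left, Equiv.swap_apply_right] at ha hb
    exact (h.2.2 b hb a ha).not_ge hab.1

section Swap

variable {T} {i : Fin n} {hi : i.val ≠ 0} {h : IsAbove (T.dom i) (T.dom (pred i))}

theorem swap_dom_self : (T.swap i hi h).dom i = T.dom (pred i) :=
  congrArg T.dom (Equiv.swap_apply_right _ _)

theorem swap_dom_pred : (T.swap i hi h).dom (pred i) = T.dom i :=
  congrArg T.dom (Equiv.swap_apply_left _ _)

theorem swap_dom_of_ne {k : Fin n} (hkp : k ≠ pred i) (hki : k ≠ i) :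
    (T.swap i hi h).dom k = T.dom k :=
  congrArg T.dom (Equiv.swap_apply_of_ne_of_ne hkp hki)

end Swap

end SDT

section Descents

variable {T : SDT μ n} {i z : Fin n}

theorem mem_Des : i ∈ Des T ↔ IsDescent T i := by
  simp [Des]

theorem mem_Des_of_ne_zero (hi : i.val ≠ 0) :
    i ∈ Des T ↔ IsAbove (T.dom (pred i)) (T.dom i) := by
  simp [mem_Des, IsDescent, hi, Nat.pos_of_ne_zero hi, IsAbove, T.nonempty_dom]

theorem mem_Des_of_eq_zero (hz : z.val = 0) : z ∈ Des T ↔ T.dom z = {(0, 0), (1, 0)} := by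
  rw [mem_Des, IsDescent]
  simp only [hz, lt_irrefl, true_and, false_and, or_false]
  exact ⟨fun h => h.eq_of_origin_mem (T.origin_mem hz), fun h => ⟨0, 0, h⟩⟩

theorem notMem_Des_of_eq_zero (hz : z.val = 0) : z ∉ Des T ↔ T.dom z = {(0, 0), (0, 1)} := by
  rw [mem_Des_of_eq_zero hz]
  refine ⟨fun h => ?_, fun h => h ▸ by decide⟩
  refine IsHorizontal.eq_of_origin_mem ((T.isDomino z).resolve_right fun hv => h ?_)
    (T.origin_mem hz)
  exact hv.eq_of_origin_mem (T.origin_mem hz)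

end Descents

/-! ### The operators `π_i` -/

section Operators

variable {T T' : SDT μ n} {i : Fin n}

theorem op_single (i : Fin n) (T : SDT μ n) : op μ i (Finsupp.single T 1) = opBasis i T := by
  simp [op]

theorem opBasis_of_mem (h : i ∈ Des T) : opBasis i T = -Finsupp.single T 1 := if_pos h

theorem opBasis_of_eq_some (h : i ∉ Des T) (hT' : sFilling T i = some T'.dom) :
    opBasis i T = Finsupp.single T' 1 := by
  have hex : ∃ T' : SDT μ n, sFilling T i = some T'.dom := ⟨T', hT'⟩
  rw [opBasis, if_neg h, dif_pos hex,
    SDT.dom_injective (Option.some_injective _ (hex.choose_spec.symm.trans hT'))]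

theorem opBasis_of_forall_ne (h : i ∉ Des T) (hT : ∀ T' : SDT μ n, sFilling T i ≠ some T'.dom) :
    opBasis i T = 0 := by
  rw [opBasis, if_neg h, dif_neg (not_exists.2 hT)]

theorem opBasis_of_isAbove (hi : i.val ≠ 0) (h : IsAbove (T.dom i) (T.dom (pred i))) :
    opBasis i T = Finsupp.single (T.swap i hi h) 1 :=
  opBasis_of_eq_some (mt (mem_Des_of_ne_zero hi).1 (asymm h)) (if_neg hi)

theorem opBasis_of_not_isAbove (hi : i.val ≠ 0) (h : ¬IsAbove (T.dom (pred i)) (T.dom i))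
    (h' : ¬IsAbove (T.dom i) (T.dom (pred i))) : opBasis i T = 0 := by
  refine opBasis_of_forall_ne (mt (mem_Des_of_ne_zero hi).1 h) fun T' hT' => ?_
  simp only [sFilling, hi, if_false, Option.some.injEq] at hT'
  obtain ⟨a, ha, b, hb, hab⟩ :=
    exists_fst_eq_of_not_isAbove (T.isDomino (pred i)) (T.isDomino i) h h'
  have ha' : a ∈ T'.dom i := by simpa [← hT'] using ha
  have hb' : b ∈ T'.dom (pred i) := by simpa [← hT'] using hb
  rcases le_total a.2 b.2 with hcol | hcol
  · exact (pred_lt hi).not_ge (T'.le_of_mem ha' hb' ⟨hab.le, hcol⟩)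
  · exact (pred_lt hi).not_ge (T.le_of_mem hb ha ⟨hab.ge, hcol⟩)

/-- The inclusion of tableaux into words of dominoes. -/
noncomputable def toWords (μ : YoungDiagram) (n : ℕ) :
    (SDT μ n →₀ ℂ) →ₗ[ℂ] ((Fin n → Finset (ℕ × ℕ)) →₀ ℂ) :=
  Finsupp.lmapDomain ℂ ℂ SDT.dom

theorem toWords_single (T : SDT μ n) :
    toWords μ n (Finsupp.single T 1) = Finsupp.single T.dom 1 :=
  Finsupp.mapDomain_single

theorem toWords_injective : Function.Injective (toWords μ n) :=
  Finsupp.mapDomain_injective SDT.dom_injective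

theorem toWords_op (hi : i.val ≠ 0) (v : SDT μ n →₀ ℂ) :
    toWords μ n (op μ i v) = sortOp IsAbove ℂ (pred i) i (toWords μ n v) := by
  suffices h : toWords μ n ∘ₗ op μ i = sortOp IsAbove ℂ (pred i) i ∘ₗ toWords μ n from
    LinearMap.congr_fun h v
  refine Finsupp.lhom_ext' fun T => LinearMap.ext_ring ?_
  change toWords μ n (op μ i (Finsupp.single T 1)) =
    sortOp IsAbove ℂ (pred i) i (toWords μ n (Finsupp.single T 1))
  rw [op_single, toWords_single]
  by_cases h : IsAbove (T.dom (pred i)) (T.dom i)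
  · rw [opBasis_of_mem ((mem_Des_of_ne_zero hi).2 h), map_neg, toWords_single, sortOp_of_rel h]
  by_cases h' : IsAbove (T.dom i) (T.dom (pred i))
  · rw [opBasis_of_isAbove hi h', toWords_single, sortOp_of_rel_swap h']
    rfl
  · rw [opBasis_of_not_isAbove hi h h', sortOp_of_not_rel h h', map_zero]

theorem commute_op_of_ne_zero {i j : Fin n} (hi : i.val ≠ 0) (hij : i.val + 2 ≤ j.val) :
    Commute (op μ i) (op μ j) := by
  refine LinearMap.ext fun v => toWords_injective ?_
  have hj : j.val ≠ 0 := by omega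
  have hpi := pred_val i
  have hpj := pred_val j
  have hcomm : Commute (sortOp IsAbove ℂ (pred i) i) (sortOp IsAbove ℂ (pred j) j) := by
    apply commute_sortOp <;> rw [Ne, Fin.ext_iff] <;> omega
  simp only [Module.End.mul_apply, toWords_op hi, toWords_op hj]
  exact LinearMap.congr_fun hcomm (toWords μ n v)

theorem op_braid {i j : Fin n} (hi : i.val ≠ 0) (hij : j.val = i.val + 1) :
    op μ i * op μ j * op μ i = op μ j * op μ i * op μ j := by
  refine LinearMap.ext fun v => toWords_injective ?_
  have hj : j.val ≠ 0 := by omega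
  have hpj : pred j = i := Fin.ext (by rw [pred_val]; omega)
  have hpi := pred_val i
  have hbraid : sortOp IsAbove ℂ (pred i) i * sortOp IsAbove ℂ i j * sortOp IsAbove ℂ (pred i) i =
      sortOp IsAbove ℂ i j * sortOp IsAbove ℂ (pred i) i * sortOp IsAbove ℂ i j := by
    apply sortOp_braid <;> rw [Ne, Fin.ext_iff] <;> omega
  simp only [Module.End.mul_apply, toWords_op hi, toWords_op hj, hpj]
  exact LinearMap.congr_fun hbraid (toWords μ n v)

end Operators

/-! ### The operator `π₀` -/

section Flip

variable {T : SDT μ n} {z o j k : Fin n} {c : ℕ × ℕ}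

theorem mem_reflect {d : Finset (ℕ × ℕ)} : c ∈ reflect d ↔ c.swap ∈ d := by
  simp [reflect, Prod.swap_eq_iff_eq_swap]

/-- The entries `1` and `2` tile the northwest `2 × 2` square by horizontal dominoes. -/
def IsFlippable (T : SDT μ n) : Prop :=
  1 < n ∧ ∀ k : Fin n, k.val ≤ 1 → T.dom k = {(k.val, 0), (k.val, 1)}

/-- The filling with the dominoes of entries `1` and `2` reflected in the main diagonal. -/
def flipDom (T : SDT μ n) (k : Fin n) : Finset (ℕ × ℕ) :=
  if k.val ≤ 1 then reflect (T.dom k) else T.dom k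

theorem flipDom_of_le_one (hk : k.val ≤ 1) : flipDom T k = reflect (T.dom k) := if_pos hk

theorem flipDom_of_one_lt (hk : 1 < k.val) : flipDom T k = T.dom k := if_neg hk.not_ge

namespace IsFlippable

theorem mem_dom (H : IsFlippable T) (hk : k.val ≤ 1) : c ∈ T.dom k ↔ c.1 = k.val ∧ c.2 ≤ 1 := by
  rw [H.2 k hk, Finset.mem_insert, Finset.mem_singleton, Prod.ext_iff, Prod.ext_iff]
  omega

theorem mem_flipDom (H : IsFlippable T) (hk : k.val ≤ 1) :
    c ∈ flipDom T k ↔ c.2 = k.val ∧ c.1 ≤ 1 := by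
  rw [flipDom_of_le_one hk, mem_reflect, H.mem_dom hk, Prod.fst_swap, Prod.snd_swap]

theorem flipDom_eq (H : IsFlippable T) (hk : k.val ≤ 1) :
    flipDom T k = {(0, k.val), (1, k.val)} := by
  rw [flipDom_of_le_one hk, H.2 k hk]
  simp [reflect]

theorem mem_cells_iff (H : IsFlippable T) (c : ℕ × ℕ) : c ∈ μ.cells ↔ ∃ k, c ∈ flipDom T k := by
  rw [T.mem_cells]
  constructor <;> rintro ⟨k, hc⟩
  · rcases le_or_gt k.val 1 with hk | hk
    · rw [H.mem_dom hk] at hc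
      exact ⟨⟨c.2, hc.2.trans_lt H.1⟩, (H.mem_flipDom hc.2).2 ⟨rfl, hc.1 ▸ hk⟩⟩
    · exact ⟨k, (flipDom_of_one_lt hk).symm ▸ hc⟩
  · rcases le_or_gt k.val 1 with hk | hk
    · rw [H.mem_flipDom hk] at hc
      exact ⟨⟨c.1, hc.2.trans_lt H.1⟩, (H.mem_dom hc.2).2 ⟨rfl, hc.1 ▸ hk⟩⟩
    · exact ⟨k, flipDom_of_one_lt hk ▸ hc⟩

theorem le_of_mem_flipDom (H : IsFlippable T) (k l : Fin n) (a : ℕ × ℕ) (ha : a ∈ flipDom T k)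
    (b : ℕ × ℕ) (hb : b ∈ flipDom T l) (hab : a ≤ b) : k ≤ l := by
  rcases le_or_gt l.val 1 with hl | hl
  · rw [H.mem_flipDom hl] at hb
    rcases le_or_gt k.val 1 with hk | hk
    · rw [H.mem_flipDom hk] at ha
      rw [Fin.le_def, ← ha.1, ← hb.1]
      exact hab.2
    · rw [flipDom_of_one_lt hk] at ha
      have hb' : b ∈ T.dom ⟨b.1, hb.2.trans_lt H.1⟩ := (H.mem_dom hb.2).2 ⟨rfl, hb.1 ▸ hl⟩
      exact absurd ((Fin.le_def.1 (T.le_of_mem ha hb' hab)).trans hb.2) hk.not_ge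
  · rcases le_or_gt k.val 1 with hk | hk
    · exact (hk.trans_lt hl).le
    · rw [flipDom_of_one_lt hk] at ha
      rw [flipDom_of_one_lt hl] at hb
      exact T.le_of_mem ha hb hab

/-- The tableau obtained by reflecting the dominoes with entries `1` and `2`. -/
def flip (H : IsFlippable T) : SDT μ n :=
  SDT.ofMonotone (flipDom T) (fun k => by
    rcases le_or_gt k.val 1 with hk | hk
    · exact Or.inr ⟨0, k.val, H.flipDom_eq hk⟩
    · rw [flipDom_of_one_lt hk]
      exact T.isDomino k) H.mem_cells_iff H.le_of_mem_flipDom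

theorem flip_dom_of_le_one (H : IsFlippable T) (hk : k.val ≤ 1) :
    H.flip.dom k = {(0, k.val), (1, k.val)} := H.flipDom_eq hk

theorem flip_dom_of_one_lt (H : IsFlippable T) (hk : 1 < k.val) : H.flip.dom k = T.dom k :=
  flipDom_of_one_lt hk

theorem notMem_Des (H : IsFlippable T) (hz : z.val = 0) : z ∉ Des T := by
  rw [notMem_Des_of_eq_zero hz, H.2 z (by omega), hz]

theorem mem_Des_flip (H : IsFlippable T) (hz : z.val = 0) : z ∈ Des H.flip := by
  rw [mem_Des_of_eq_zero hz, H.flip_dom_of_le_one (by omega), hz]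

theorem opBasis_eq (H : IsFlippable T) (hz : z.val = 0) :
    opBasis z T = Finsupp.single H.flip 1 := by
  refine opBasis_of_eq_some (H.notMem_Des hz) ?_
  rw [sFilling, if_pos hz, dif_pos H.1, if_pos]
  · rfl
  · rw [H.2 z (by omega), H.2 ⟨1, H.1⟩ le_rfl, hz]
    rfl

end IsFlippable

theorem opBasis_of_not_isFlippable (hz : z.val = 0) (h : z ∉ Des T) (hT : ¬IsFlippable T) :
    opBasis z T = 0 := by
  refine opBasis_of_forall_ne h fun T' hT' => hT ?_
  rw [notMem_Des_of_eq_zero hz] at h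
  rw [sFilling, if_pos hz] at hT'
  split_ifs at hT' with hn hsquare
  have hdisj : Disjoint (T.dom z) (T.dom ⟨1, hn⟩) := T.disjoint _ _ (by simp [Fin.ext_iff, hz])
  have hone : T.dom ⟨1, hn⟩ = {(1, 0), (1, 1)} := by
    rw [← Finset.union_sdiff_cancel_left hdisj, hsquare, h]
    decide
  refine ⟨hn, fun k hk => ?_⟩
  obtain rfl | rfl : k = z ∨ k = ⟨1, hn⟩ := by simp only [Fin.ext_iff]; omega
  · rw [h, hz]
  · exact hone

theorem pred_eq_zero (hz : z.val = 0) (ho : o.val = 1) : pred o = z :=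
  Fin.ext (by rw [pred_val]; omega)

theorem exists_op_one_single_eq_smul (hz : z.val = 0) (ho : o.val = 1) (T : SDT μ n) :
    ∃ c : ℂ, op μ o (Finsupp.single T 1) = c • Finsupp.single T 1 := by
  have ho' : o.val ≠ 0 := by omega
  rw [op_single]
  by_cases h : IsAbove (T.dom (pred o)) (T.dom o)
  · exact ⟨-1, by rw [opBasis_of_mem ((mem_Des_of_ne_zero ho').2 h), neg_one_smul]⟩
  · refine ⟨0, ?_⟩
    rw [opBasis_of_not_isAbove ho' h, zero_smul]
    rintro ⟨⟨a, ha⟩, -, hlt⟩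
    rw [pred_eq_zero hz ho] at hlt
    exact (hlt a ha _ (T.origin_mem hz)).not_ge a.1.zero_le

theorem IsFlippable.op_one_flip (H : IsFlippable T) (ho : o.val = 1) :
    op μ o (Finsupp.single H.flip 1) = 0 := by
  rw [op_single]
  apply opBasis_of_not_isAbove (by omega) <;>
    rw [H.flip_dom_of_le_one ho.le, H.flip_dom_of_le_one (by rw [pred_val]; omega)] <;>
    exact fun h => (h.2.2 _ (Finset.mem_insert_self _ _) _ (Finset.mem_insert_self _ _)).false

theorem op_braidFour (hz : z.val = 0) (ho : o.val = 1) :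
    op μ z * op μ o * op μ z * op μ o = op μ o * op μ z * op μ o * op μ z := by
  refine Finsupp.lhom_ext' fun T => LinearMap.ext_ring ?_
  change op μ z (op μ o (op μ z (op μ o (Finsupp.single T 1)))) =
    op μ o (op μ z (op μ o (op μ z (Finsupp.single T 1))))
  obtain ⟨c, hc⟩ := exists_op_one_single_eq_smul hz ho T
  by_cases h : z ∈ Des T
  · have hop := opBasis_of_mem h
    rw [← op_single] at hop
    simp only [hc, map_smul, hop, map_neg, smul_neg]
  by_cases H : IsFlippable T
  · have hop := H.opBasis_eq hz
    rw [← op_single] at hop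
    simp only [hc, map_smul, hop, H.op_one_flip ho, map_zero, smul_zero]
  · have hop := opBasis_of_not_isFlippable hz h H
    rw [← op_single] at hop
    simp only [hc, map_smul, hop, map_zero, smul_zero]

section Swap

variable {hj0 : j.val ≠ 0} {h : IsAbove (T.dom j) (T.dom (pred j))}

theorem mem_Des_zero_swap (hz : z.val = 0) (hj : 2 ≤ j.val) :
    z ∈ Des (T.swap j hj0 h) ↔ z ∈ Des T := by
  have hp := pred_val j
  rw [mem_Des_of_eq_zero hz, mem_Des_of_eq_zero hz, SDT.swap_dom_of_ne] <;>
    rw [Ne, Fin.ext_iff] <;> omega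

theorem swap_dom_of_le_one (hj : 3 ≤ j.val) (hk : k.val ≤ 1) :
    (T.swap j hj0 h).dom k = T.dom k := by
  have hp := pred_val j
  apply SDT.swap_dom_of_ne <;> rw [Ne, Fin.ext_iff] <;> omega

theorem isFlippable_swap_iff (hj : 3 ≤ j.val) : IsFlippable (T.swap j hj0 h) ↔ IsFlippable T :=
  and_congr_right fun _ => forall₂_congr fun _ hk => by rw [swap_dom_of_le_one hj hk]

theorem not_isFlippable_swap_two (hj : j.val = 2) : ¬IsFlippable (T.swap j hj0 h) := by
  intro H
  have hmem : (1, 0) ∈ T.dom j := by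
    rw [← SDT.swap_dom_pred (hi := hj0) (h := h), H.mem_dom] <;> simp [pred_val, hj]
  obtain ⟨b, hb⟩ := T.nonempty_dom (pred j)
  exact (pred_lt hj0).not_ge (T.le_of_mem hmem hb ⟨(h.2.2 _ hmem b hb).le, b.2.zero_le⟩)

end Swap

theorem op_zero_opBasis_of_mem (hz : z.val = 0) (hj : 2 ≤ j.val) (h : z ∈ Des T) :
    op μ z (opBasis j T) = -opBasis j T := by
  have hj0 : j.val ≠ 0 := by omega
  by_cases hdes : IsAbove (T.dom (pred j)) (T.dom j)
  · rw [opBasis_of_mem ((mem_Des_of_ne_zero hj0).2 hdes), map_neg, op_single, opBasis_of_mem h]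
  by_cases hasc : IsAbove (T.dom j) (T.dom (pred j))
  · rw [opBasis_of_isAbove hj0 hasc, op_single, opBasis_of_mem ((mem_Des_zero_swap hz hj).2 h)]
  · rw [opBasis_of_not_isAbove hj0 hdes hasc, map_zero, neg_zero]

theorem op_zero_opBasis_of_not_isFlippable (hz : z.val = 0) (hj : 2 ≤ j.val) (h : z ∉ Des T)
    (hT : ¬IsFlippable T) : op μ z (opBasis j T) = 0 := by
  have hj0 : j.val ≠ 0 := by omega
  by_cases hdes : IsAbove (T.dom (pred j)) (T.dom j)
  · rw [opBasis_of_mem ((mem_Des_of_ne_zero hj0).2 hdes), map_neg, op_single,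
      opBasis_of_not_isFlippable hz h hT, neg_zero]
  by_cases hasc : IsAbove (T.dom j) (T.dom (pred j))
  · rw [opBasis_of_isAbove hj0 hasc, op_single]
    refine opBasis_of_not_isFlippable hz (mt (mem_Des_zero_swap hz hj).1 h) ?_
    rcases hj.eq_or_lt with hj | hj
    · exact not_isFlippable_swap_two hj.symm
    · exact mt (isFlippable_swap_iff hj).1 hT
  · rw [opBasis_of_not_isAbove hj0 hdes hasc, map_zero]

namespace IsFlippable

theorem isAbove_flip_iff (H : IsFlippable T) (hj : 2 ≤ j.val) :
    IsAbove (H.flip.dom (pred j)) (H.flip.dom j) ↔ IsAbove (T.dom (pred j)) (T.dom j) := by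
  have hp := pred_val j
  rw [H.flip_dom_of_one_lt hj]
  rcases hj.eq_or_lt with hj | hj
  · have hp1 : (pred j).val = 1 := by omega
    rw [H.flip_dom_of_le_one hp1.le, H.2 _ hp1.le, hp1]
    simp only [IsAbove, Finset.insert_nonempty, true_and, Finset.forall_mem_insert,
      Finset.mem_singleton, forall_eq]
    grind
  · rw [H.flip_dom_of_one_lt (by omega)]

theorem not_isAbove_flip_two (H : IsFlippable T) (hj : j.val = 2) :
    ¬IsAbove (H.flip.dom j) (H.flip.dom (pred j)) := by
  rintro ⟨⟨a, ha⟩, -, hlt⟩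
  have hp : (pred j).val ≤ 1 := by rw [pred_val]; omega
  rw [H.flip_dom_of_le_one hp] at hlt
  exact (hlt a ha _ (Finset.mem_insert_self _ _)).not_ge a.1.zero_le

theorem flip_swap (H : IsFlippable T) (hj : 3 ≤ j.val) {hj0 : j.val ≠ 0}
    (h : IsAbove (T.dom j) (T.dom (pred j)))
    (h' : IsAbove (H.flip.dom j) (H.flip.dom (pred j))) :
    ((isFlippable_swap_iff hj).2 H : IsFlippable (T.swap j hj0 h)).flip = H.flip.swap j hj0 h' := by
  refine SDT.ext (funext fun k => ?_)
  rcases le_or_gt k.val 1 with hk | hk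
  · rw [flip_dom_of_le_one _ hk, swap_dom_of_le_one hj hk, H.flip_dom_of_le_one hk]
  · rw [flip_dom_of_one_lt _ hk]
    refine (H.flip_dom_of_one_lt ?_).symm
    have hp := pred_val j
    rw [Equiv.swap_apply_def]
    split_ifs <;> omega

theorem op_zero_opBasis (H : IsFlippable T) (hz : z.val = 0) (hj : 2 ≤ j.val) :
    op μ z (opBasis j T) = opBasis j H.flip := by
  have hj0 : j.val ≠ 0 := by omega
  by_cases hdes : IsAbove (T.dom (pred j)) (T.dom j)
  · rw [opBasis_of_mem ((mem_Des_of_ne_zero hj0).2 hdes), map_neg, op_single, H.opBasis_eq hz,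
      opBasis_of_mem ((mem_Des_of_ne_zero hj0).2 ((H.isAbove_flip_iff hj).2 hdes))]
  have hdes' := mt (H.isAbove_flip_iff hj).1 hdes
  rcases hj.eq_or_lt with hj2 | hj3
  · rw [opBasis_of_not_isAbove hj0 hdes' (H.not_isAbove_flip_two hj2.symm)]
    by_cases hasc : IsAbove (T.dom j) (T.dom (pred j))
    · rw [opBasis_of_isAbove hj0 hasc, op_single]
      exact opBasis_of_not_isFlippable hz (mt (mem_Des_zero_swap hz hj).1 (H.notMem_Des hz))
        (not_isFlippable_swap_two hj2.symm)
    · rw [opBasis_of_not_isAbove hj0 hdes hasc, map_zero]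
  · have hj1 := H.flip_dom_of_one_lt hj
    have hp1 := H.flip_dom_of_one_lt (k := pred j) (by rw [pred_val]; omega)
    by_cases hasc : IsAbove (T.dom j) (T.dom (pred j))
    · have hasc' : IsAbove (H.flip.dom j) (H.flip.dom (pred j)) := by rwa [hj1, hp1]
      rw [opBasis_of_isAbove hj0 hasc, opBasis_of_isAbove hj0 hasc', op_single,
        ((isFlippable_swap_iff hj3).2 H).opBasis_eq hz, H.flip_swap hj3 hasc hasc']
    · rw [opBasis_of_not_isAbove hj0 hdes hasc, map_zero,
        opBasis_of_not_isAbove hj0 hdes' (by rwa [hj1, hp1])]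

end IsFlippable

theorem commute_op_zero (hz : z.val = 0) (hj : 2 ≤ j.val) : Commute (op μ z) (op μ j) := by
  refine Finsupp.lhom_ext' fun T => LinearMap.ext_ring ?_
  change op μ z (op μ j (Finsupp.single T 1)) = op μ j (op μ z (Finsupp.single T 1))
  rw [op_single, op_single]
  by_cases h : z ∈ Des T
  · rw [op_zero_opBasis_of_mem hz hj h, opBasis_of_mem h, map_neg, op_single]
  by_cases H : IsFlippable T
  · rw [H.op_zero_opBasis hz hj, H.opBasis_eq hz, op_single]
  · rw [op_zero_opBasis_of_not_isFlippable hz hj h H, opBasis_of_not_isFlippable hz h H, map_zero]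

end Flip

/-! ### Triangularity -/

variable {T : SDT μ n} {i j : Fin n}

/-- A statistic on tableaux that the exchanges `s_i` increase outside descents: the bottom rows
of the dominoes, weighted by their entries. -/
def height (T : SDT μ n) : ℕ := ∑ k : Fin n, (k.val + 1) * (T.dom k).sup Prod.fst

theorem sum_lt_sum_of_eqOn_compl_pair {κ M : Type*} [Fintype κ] [AddCommMonoid M] [PartialOrder M]
    [IsOrderedCancelAddMonoid M] {f g : κ → M} {p q : κ} (hpq : p ≠ q)
    (heq : ∀ k, k ≠ p → k ≠ q → f k = g k) (hlt : f p + f q < g p + g q) :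
    ∑ k, f k < ∑ k, g k := by
  classical
  have hcompl : ∑ k ∈ ({p, q} : Finset κ)ᶜ, f k = ∑ k ∈ ({p, q} : Finset κ)ᶜ, g k :=
    Finset.sum_congr rfl fun k hk => by
      simp only [Finset.mem_compl, Finset.mem_insert, Finset.mem_singleton, not_or] at hk
      exact heq k hk.1 hk.2
  rw [← Finset.sum_add_sum_compl {p, q} f, ← Finset.sum_add_sum_compl {p, q} g, hcompl,
    Finset.sum_pair hpq, Finset.sum_pair hpq]
  exact add_lt_add_left hlt _

theorem height_lt_swap {hi : i.val ≠ 0} (h : IsAbove (T.dom i) (T.dom (pred i))) :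
    height T < height (T.swap i hi h) := by
  refine sum_lt_sum_of_eqOn_compl_pair (pred_lt hi).ne
    (fun k hp hk => by rw [SDT.swap_dom_of_ne hp hk]) ?_
  have hlt := h.sup_fst_lt
  have hpred : (pred i).val + 1 = i.val := by rw [pred_val]; omega
  rw [SDT.swap_dom_pred, SDT.swap_dom_self, hpred]
  nlinarith

theorem IsFlippable.height_lt_flip (H : IsFlippable T) : height T < height H.flip := by
  have hsup : ∀ k : Fin n, k.val ≤ 1 →
      (T.dom k).sup Prod.fst = k.val ∧ (H.flip.dom k).sup Prod.fst = 1 := fun k hk => by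
    rw [H.2 k hk, H.flip_dom_of_le_one hk]
    simp
  refine Finset.sum_lt_sum (fun k _ => Nat.mul_le_mul_left _ ?_)
    ⟨⟨0, H.1.pos⟩, Finset.mem_univ _, ?_⟩
  · rcases le_or_gt k.val 1 with hk | hk
    · rwa [(hsup k hk).1, (hsup k hk).2]
    · rw [H.flip_dom_of_one_lt hk]
  · rw [(hsup ⟨0, H.1.pos⟩ zero_le_one).1, (hsup ⟨0, H.1.pos⟩ zero_le_one).2]
    simp

theorem opBasis_eq_zero_or_single (h : i ∉ Des T) :
    opBasis i T = 0 ∨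
      ∃ T', i ∈ Des T' ∧ height T < height T' ∧ opBasis i T = Finsupp.single T' 1 := by
  by_cases hi : i.val = 0
  · by_cases H : IsFlippable T
    · exact Or.inr ⟨H.flip, H.mem_Des_flip hi, H.height_lt_flip, H.opBasis_eq hi⟩
    · exact Or.inl (opBasis_of_not_isFlippable hi h H)
  · by_cases hasc : IsAbove (T.dom i) (T.dom (pred i))
    · refine Or.inr ⟨T.swap i hi hasc, (mem_Des_of_ne_zero hi).2 ?_, height_lt_swap hasc,
        opBasis_of_isAbove hi hasc⟩
      rwa [SDT.swap_dom_pred, SDT.swap_dom_self]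
    · exact Or.inl (opBasis_of_not_isAbove hi (mt (mem_Des_of_ne_zero hi).2 h) hasc)

/-! ### The module of standard domino tableaux -/

theorem op_mul_self (i : Fin n) : op μ i * op μ i = -op μ i := by
  refine Finsupp.lhom_ext' fun T => LinearMap.ext_ring ?_
  change op μ i (op μ i (Finsupp.single T 1)) = -op μ i (Finsupp.single T 1)
  by_cases h : i ∈ Des T
  · rw [op_single, opBasis_of_mem h, map_neg, op_single, opBasis_of_mem h]
  rw [op_single]
  obtain hzero | ⟨T', hT', -, hsingle⟩ := opBasis_eq_zero_or_single h
  · rw [hzero, map_zero, neg_zero]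
  · rw [hsingle, op_single, opBasis_of_mem hT']

theorem commute_op (hij : i.val + 2 ≤ j.val) : Commute (op μ i) (op μ j) := by
  by_cases hi : i.val = 0
  · exact commute_op_zero hi (by omega)
  · exact commute_op_of_ne_zero hi hij

/-- The representation of the type-`B` 0-Hecke algebra on `ℂ SDT(μ)` by the operators `π_i`. -/
noncomputable def dominoRep (μ : YoungDiagram) (n : ℕ) :
    HeckeB n →ₐ[ℂ] Module.End ℂ (SDT μ n →₀ ℂ) :=
  RingQuot.liftAlgHom ℂ ⟨FreeAlgebra.lift ℂ (op μ), by
    rintro _ _ (i | ⟨_, _, hij⟩ | ⟨_, _, hi, hij⟩ | ⟨_, _, hi, hj⟩) <;>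
      simp only [map_mul, map_neg, FreeAlgebra.lift_ι_apply]
    · exact op_mul_self i
    · exact commute_op hij
    · exact op_braid (Nat.one_le_iff_ne_zero.1 hi) hij
    · exact op_braidFour hi hj⟩

theorem dominoRep_gen (i : Fin n) : dominoRep μ n (gen i) = op μ i := by
  simp [dominoRep, gen]

/-- The basis of `ℂ SDT(μ)` consisting of the tableaux. -/
noncomputable def tableauBasis (μ : YoungDiagram) (n : ℕ) :
    Module.Basis (SDT μ n) ℂ (RepModule (dominoRep μ n)) :=
  (Finsupp.basisSingleOne : Module.Basis (SDT μ n) ℂ (SDT μ n →₀ ℂ))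

theorem gen_smul_tableauBasis (i : Fin n) (T : SDT μ n) :
    gen i • tableauBasis μ n T = (opBasis i T : SDT μ n →₀ ℂ) := by
  change dominoRep μ n (gen i) (Finsupp.single T 1) = opBasis i T
  rw [dominoRep_gen, op_single]

theorem gen_smul_tableauBasis_of_mem (h : i ∈ Des T) :
    gen i • tableauBasis μ n T = -tableauBasis μ n T :=
  (gen_smul_tableauBasis i T).trans (opBasis_of_mem h)

theorem gen_smul_tableauBasis_eq_zero_or_tableauBasis (h : i ∉ Des T) :
    gen i • tableauBasis μ n T = 0 ∨
      ∃ T', height T < height T' ∧ gen i • tableauBasis μ n T = tableauBasis μ n T' := by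
  obtain hzero | ⟨T', -, hlt, hsingle⟩ := opBasis_eq_zero_or_single h
  · exact Or.inl ((gen_smul_tableauBasis i T).trans hzero)
  · exact Or.inr ⟨T', hlt, (gen_smul_tableauBasis i T).trans hsingle⟩

theorem isTriangular_tableauBasis (μ : YoungDiagram) (n : ℕ) :
    IsTriangular (tableauBasis μ n) Des height := by
  intro i T
  by_cases h : i ∈ Des T
  · rw [gen_smul_tableauBasis_of_mem h, if_pos h, neg_one_smul, sub_self]
    exact zero_mem _
  rw [if_neg h, zero_smul, sub_zero]
  obtain hzero | ⟨T', hlt, hT'⟩ := gen_smul_tableauBasis_eq_zero_or_tableauBasis h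
  · rw [hzero]
    exact zero_mem _
  · rw [hT']
    exact Submodule.subset_span (Set.mem_image_of_mem _ hlt)

end DominoHecke

theorem mainTheorem8 (n : ℕ) (μ : YoungDiagram) (hμ : μ.card = 2 * n) :
    (∃ ch : DominoHecke.G0 n →+ DominoHecke.QSymB, DominoHecke.IsCharB ch) ∧
    ∃ ρ : DominoHecke.HeckeB n →ₐ[ℂ] Module.End ℂ (DominoHecke.SDT μ n →₀ ℂ),
      (∀ i : Fin n, ρ (DominoHecke.gen i) = DominoHecke.op μ i) ∧
      ∀ ch : DominoHecke.G0 n →+ DominoHecke.QSymB, DominoHecke.IsCharB ch →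
        (ch (DominoHecke.G0.cls n (DominoHecke.RepModule ρ)) : MvPowerSeries ℕ ℂ) =
          DominoHecke.dominoFunction μ n := by
  refine ⟨⟨_, DominoHecke.isCharB_characteristic n⟩, DominoHecke.dominoRep μ n,
    DominoHecke.dominoRep_gen, fun ch hch => ?_⟩
  have hsimple (T : DominoHecke.SDT μ n) : (ch (DominoHecke.G0.cls n
      (DominoHecke.SimpleB (DominoHecke.Des T))) : MvPowerSeries ℕ ℂ) =
        DominoHecke.FB (DominoHecke.Des T) := hch _
  rw [(DominoHecke.isTriangular_tableauBasis μ n).cls_eq_sum, map_sum, Submodule.coe_sum]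
  simp only [hsimple, DominoHecke.dominoFunction]
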